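/- Let $p\ge 0$ be an integer and, for $i,j=1,\dots,p$, let $H_i\in(0,1)$, $\sigma_i>0$ and - if $H_i+H_j\neq 1$: $(\rho_{i,j},\eta_{i,j})\in[-1,1]\times\mathbb R$ with $\rho_{j,i}=\rho_{i,j}$, $\eta_{j,i}=-\eta_{i,j}$, and $\rho_{i,i}=1$ (when $2H_i\ne1$); - if $H_i+H_j=1$: $(\tilde\rho_{i,j},\tilde\eta_{i,j})\in[-1,1]\times\mathbb R$ with $\tilde\rho_{j,i}=\tilde\rho_{i,j}$, $\tilde\eta_{j,i}=-\tilde\eta_{i,j}$, and $\tilde\rho_{i,i}=1$ (when $2H_i=1$). For $s,t\in\mathbb R$ define the matrix $\Sigma(s,t)=(\Sigma_{i,j}(s,t))_{1\le i,j\le p}$ by $$\Sigma_{i,i}(s,t)=\frac{\sigma_i^2}{2}\left\{|s|^{2H_i}+|t|^{2H_i}-|t-s|^{2H_i}\right\},$$ and for $i\ne j$, with $0\log 0=0$ and $\operatorname{sign}(0)=0$, by $$\Sigma_{i,j}(s,t)=\frac{\sigma_i\sigma_j}{2}\left\{(\rho_{i,j}+\eta_{i,j}\operatorname{sign}(s))|s|^{H_i+H_j}+(\rho_{i,j}-\eta_{i,j}\operatorname{sign}(t))|t|^{H_i+H_j}-(\rho_{i,j}-\eta_{i,j}\operatorname{sign}(t-s))|t-s|^{H_i+H_j}\right\}$$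 if $H_i+H_j\ne 1$, and $$\Sigma_{i,j}(s,t)=\frac{\sigma_i\sigma_j}{2}\left\{\tilde\rho_{i,j}(|s|+|t|-|s-t|)+\tilde\eta_{i,j}\left(t\log|t|-s\log|s|-(t-s)\log|t-s|\right)\right\}$$ if $H_i+H_j=1$. Let $Q=\left(\Gamma(H_i+H_j+1)\,\tau_{i,j}(1)\right)_{1\le i,j\le p}$, where $$\tau_{i,j}(1)=\begin{cases}\rho_{i,j}\sin\left(\frac\pi2(H_i+H_j)\right)-\mathbf i\,\eta_{i,j}\cos\left(\frac\pi2(H_i+H_j)\right)&\text{if }H_i+H_j\ne1,\\ \tilde\rho_{i,j}-\mathbf i\,\frac\pi2\tilde\eta_{i,j}&\text{if }H_i+H_j=1.\end{cases}$$ A multivariate fractional Brownian motion (mfBm) with parameter $H=(H_1,\dots,H_p)$ is a Gaussian process $X=(X_1(t),\dots,X_p(t))_{t\in\mathbb R}$ with stationary increments such that, for every $\lambda>0$, $(X_1(\lambda t),\dots,X_p(\lambda t))_{t\in\mathbb R}$ and $(\lambda^{H_1}X_1(t),\dots,\lambda^{H_p}X_p(t))_{t\in\mathbb R}$ have the same finite-dimensional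 distributions. Then the following are equivalent: (a) $\Sigma$ is the covariance matrix function of some mfBm with parameter $H$, i.e. $\operatorname{Cov}(X_i(s),X_j(t))=\Sigma_{i,j}(s,t)$ for all $s,t,i,j$; (b) $\Sigma$ is the covariance matrix function of some $p$-variate process with finite second moments; (c) the matrix $Q$ is Hermitian positive semidefinite. When $p=2$, condition (c) is equivalent to $C_{1,2}\le1$, where $C_{1,2}$ is the coherence $$C_{1,2}=\frac{\Gamma(H_1+H_2+1)^2}{\Gamma(2H_1+1)\Gamma(2H_2+1)}\;\frac{c_{1,2}}{\sin(\pi H_1)\sin(\pi H_2)},$$ with $c_{1,2}=\rho_{1,2}^2\sin^2\left(\frac\pi2(H_1+H_2)\right)+\eta_{1,2}^2\cos^2\left(\frac\pi2(H_1+H_2)\right)$ if $H_1+H_2\ne1$ and $c_{1,2}=\tilde\rho_{1,2}^2+\frac{\pi^2}{4}\tilde\eta_{1,2}^2$ if $H_1+H_2=1$. -/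

import Mathlib

open MeasureTheory ProbabilityTheory
open scoped ComplexOrder

/-- Two processes `X`, `Y` on the same probability space have the same finite-dimensional
distributions. -/
def SameFDD {T Ω E : Type*} [MeasurableSpace Ω] [MeasurableSpace E] (P : Measure Ω)
    (X Y : T → Ω → E) : Prop :=
  ∀ I : Finset T,
    IdentDistrib (fun ω ↦ I.restrict (fun t ↦ X t ω)) (fun ω ↦ I.restrict (fun t ↦ Y t ω)) P P

/-- `X` is a `p`-variate process indexed by `ℝ`, jointly self-similar with parameter `H`:
`(X₁(lt), …, X_p(lt))_t` and `(l ^ H₁ X₁(t), …, l ^ H_p X_p(t))_t` have the same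
finite-dimensional distributions for every `l > 0`. -/
def IsSelfSimilar {p : ℕ} {Ω : Type*} [MeasurableSpace Ω] (H : Fin p → ℝ)
    (X : ℝ → Ω → (Fin p → ℝ)) (P : Measure Ω) : Prop :=
  ∀ l : ℝ, 0 < l → SameFDD P (fun t ω ↦ X (l * t) ω) (fun t ω i ↦ l ^ H i * X t ω i)

/-- Stationarity of the increments: for every `h`, the processes `(X(t + h) - X(h))_t` and
`(X(t) - X(0))_t` have the same finite-dimensional distributions. -/
def HasStationaryIncrements {p : ℕ} {Ω : Type*} [MeasurableSpace Ω]
    (X : ℝ → Ω → (Fin p → ℝ)) (P : Measure Ω) : Prop :=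
  ∀ h : ℝ, SameFDD P (fun t ω ↦ X (t + h) ω - X h ω) (fun t ω ↦ X t ω - X 0 ω)

/-- `X` is a multivariate fractional Brownian motion with parameter `H ∈ (0,1)^p`. -/
structure IsMfBm {p : ℕ} {Ω : Type*} [MeasurableSpace Ω] (H : Fin p → ℝ)
    (X : ℝ → Ω → (Fin p → ℝ)) (P : Measure Ω) : Prop where
  mem_Ioo : ∀ i, H i ∈ Set.Ioo (0 : ℝ) 1
  gaussian : IsGaussianProcess X P
  selfSimilar : IsSelfSimilar H X P
  stationaryIncrements : HasStationaryIncrements X P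

/-- `X` has finite second moments and covariance matrix function `S`:
`S s t i j = Cov (X_i(s), X_j(t))`. -/
def HasCovarianceMatrixFunction {p : ℕ} {Ω : Type*} [MeasurableSpace Ω]
    (X : ℝ → Ω → (Fin p → ℝ)) (P : Measure Ω) (S : ℝ → ℝ → Matrix (Fin p) (Fin p) ℝ) : Prop :=
  (∀ t i, MemLp (fun ω ↦ X t ω i) 2 P) ∧
    ∀ s t i j, cov[fun ω ↦ X s ω i, fun ω ↦ X t ω j; P] = S s t i j

/-- `S` is the covariance matrix function of some second-order process. -/
def IsCovarianceMatrixFunction {p : ℕ} (S : ℝ → ℝ → Matrix (Fin p) (Fin p) ℝ) : Prop :=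
  ∃ (Ω : Type) (_ : MeasurableSpace Ω) (P : Measure Ω) (X : ℝ → Ω → (Fin p → ℝ)),
    IsProbabilityMeasure P ∧ HasCovarianceMatrixFunction X P S

/-- `S` is the covariance matrix function of some multivariate fractional Brownian motion with
parameter `H`. -/
def IsMfBmCovariance {p : ℕ} (H : Fin p → ℝ)
    (S : ℝ → ℝ → Matrix (Fin p) (Fin p) ℝ) : Prop :=
  ∃ (Ω : Type) (_ : MeasurableSpace Ω) (P : Measure Ω) (X : ℝ → Ω → (Fin p → ℝ)),
    IsProbabilityMeasure P ∧ IsMfBm H X P ∧ HasCovarianceMatrixFunction X P S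

/-- The parameters `H_i, σ_i` and, for each pair `(i, j)`, `ρ_ij, η_ij` (relevant only when
`H_i + H_j ≠ 1`) or `ρ̃_ij, η̃_ij` (here `ρt`, `ηt`, relevant only when `H_i + H_j = 1`), with the
convention `ρ_ii = 1`, resp. `ρ̃_ii = 1`, on the diagonal. -/
structure MfBmParams (p : ℕ) where
  H : Fin p → ℝ
  σ : Fin p → ℝ
  ρ : Fin p → Fin p → ℝ
  η : Fin p → Fin p → ℝ
  ρt : Fin p → Fin p → ℝ
  ηt : Fin p → Fin p → ℝ
  H_mem : ∀ i, H i ∈ Set.Ioo (0 : ℝ) 1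
  σ_pos : ∀ i, 0 < σ i
  ρ_mem : ∀ i j, H i + H j ≠ 1 → ρ i j ∈ Set.Icc (-1 : ℝ) 1
  ρ_symm : ∀ i j, H i + H j ≠ 1 → ρ j i = ρ i j
  η_antisymm : ∀ i j, H i + H j ≠ 1 → η j i = -η i j
  ρ_self : ∀ i, H i + H i ≠ 1 → ρ i i = 1
  ρt_mem : ∀ i j, H i + H j = 1 → ρt i j ∈ Set.Icc (-1 : ℝ) 1
  ρt_symm : ∀ i j, H i + H j = 1 → ρt j i = ρt i j
  ηt_antisymm : ∀ i j, H i + H j = 1 → ηt j i = -ηt i j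
  ρt_self : ∀ i, H i + H i = 1 → ρt i i = 1

namespace MfBmParams

noncomputable section

/-- The matrix function `Σ(s,t)`. -/
def covMatrix {p : ℕ} (θ : MfBmParams p) (s t : ℝ) : Matrix (Fin p) (Fin p) ℝ :=
  Matrix.of fun i j ↦
    if i = j then
      θ.σ i ^ 2 / 2 * (|s| ^ (2 * θ.H i) + |t| ^ (2 * θ.H i) - |t - s| ^ (2 * θ.H i))
    else if θ.H i + θ.H j ≠ 1 then
      θ.σ i * θ.σ j / 2 *
        ((θ.ρ i j + θ.η i j * Real.sign s) * |s| ^ (θ.H i + θ.H j)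
          + (θ.ρ i j - θ.η i j * Real.sign t) * |t| ^ (θ.H i + θ.H j)
          - (θ.ρ i j - θ.η i j * Real.sign (t - s)) * |t - s| ^ (θ.H i + θ.H j))
    else
      θ.σ i * θ.σ j / 2 *
        (θ.ρt i j * (|s| + |t| - |s - t|)
          + θ.ηt i j * (t * Real.log |t| - s * Real.log |s| - (t - s) * Real.log |t - s|))

/-- `τ_ij(ε)`, for a sign `ε`. -/
def tau {p : ℕ} (θ : MfBmParams p) (i j : Fin p) (ε : ℝ) : ℂ :=
  if θ.H i + θ.H j ≠ 1 then
    ((θ.ρ i j * Real.sin (Real.pi / 2 * (θ.H i + θ.H j)) : ℝ) : ℂ)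
      - Complex.I * ((θ.η i j * ε * Real.cos (Real.pi / 2 * (θ.H i + θ.H j)) : ℝ) : ℂ)
  else
    (θ.ρt i j : ℂ) - Complex.I * ((Real.pi / 2 * θ.ηt i j * ε : ℝ) : ℂ)

/-- The Hermitian matrix `Q = (Γ(H_i + H_j + 1) τ_ij(1))`. -/
def Q {p : ℕ} (θ : MfBmParams p) : Matrix (Fin p) (Fin p) ℂ :=
  Matrix.of fun i j ↦ (Real.Gamma (θ.H i + θ.H j + 1) : ℂ) * θ.tau i j 1

/-- The (frequency-independent) coherence `C_ij` between the increments of the components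
`i` and `j`. -/
def coherence {p : ℕ} (θ : MfBmParams p) (i j : Fin p) : ℝ :=
  Real.Gamma (θ.H i + θ.H j + 1) ^ 2
      / (Real.Gamma (2 * θ.H i + 1) * Real.Gamma (2 * θ.H j + 1))
    * ((if θ.H i + θ.H j ≠ 1 then
          θ.ρ i j ^ 2 * Real.sin (Real.pi / 2 * (θ.H i + θ.H j)) ^ 2
            + θ.η i j ^ 2 * Real.cos (Real.pi / 2 * (θ.H i + θ.H j)) ^ 2
        else
          θ.ρt i j ^ 2 + Real.pi ^ 2 / 4 * θ.ηt i j ^ 2)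
      / (Real.sin (Real.pi * θ.H i) * Real.sin (Real.pi * θ.H j)))

end

end MfBmParams

open Filter Topology

/-! The heart is a spectral representation, `covMatrix_eq`: Σ_ij(s,t) = (σ_i σ_j / π) Re(Q_ij
S_h(s,t)), where h = H_i + H_j and S_h(s,t) = ∫₀^∞ x^(-1-h) (e^(itx) - 1)(e^(-isx) - 1) dx. To
evaluate S_h, write Γ(1+h) x^(-1-h) as the Laplace transform of y^h and exchange the integrals. What
remains is y^h times a rational function of y, and its integral yields powers |a|^h, or the terms a
log|a| when h = 1 (`spectralIntegral_re`, `spectralIntegral_im`, `spectralIntegral_one_im`).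

If Q is positive semidefinite, split x^(-1-H_i-H_j) = x^(-1/2-H_i) x^(-1/2-H_j): every quadratic
form of Σ becomes the real part of an integral of w(x)* Q w(x), up to 1/π, so Σ is a positive
semidefinite kernel (`posSemidef_covKernel`). A centered Gaussian process with this covariance
exists (`exists_isGaussianProcess`). The substitution x → lx and the modulation by e^(irx) show that
rescaling, resp. taking increments, acts on Σ as required, and covariances determine centered
Gaussian laws.

Conversely, suppose Σ is a covariance and let f_z(x) be the spectral density contracted with z ∈
ℂ^p. Nonnegativity of variances gives ∫ f_z |D|² ≥ 0 for every combination D of the functions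
e^(iτx) - 1 (`re_integral_combinedDensity_nonneg`). Taking D = (e^(ix) - 1) cos(b(x-1))^n and
letting the weights concentrate at x = 1 yields f_z(1) = z* Q z ≥ 0.

For p = 2 the coherence is |Q_12|² / (Q_11 Q_22), so the bound is the determinant condition. -/

/-! ### Mellin transforms of Laplace transforms -/

/-- This licenses Fubini in the next two results. By Tonelli, integrating the norm in y first gives
Γ(b) x^(-b) ‖k x‖, which is integrable by `hi`. -/
theorem integrable_prod_laplace {b : ℝ} (hb : 0 < b) {k : ℝ → ℂ}
    (hk : Measurable k) (hi : IntegrableOn (fun x : ℝ ↦ (x ^ (-b) : ℝ) • k x) (Set.Ioi 0)) :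
    Integrable (fun q : ℝ × ℝ ↦ (q.2 ^ (b - 1) * Real.exp (-(q.1 * q.2))) • k q.1)
      ((volume.restrict (Set.Ioi 0)).prod (volume.restrict (Set.Ioi 0))) := by
  have hG : ∀ x : ℝ, 0 < x →
      ∫ y in Set.Ioi (0 : ℝ), y ^ (b - 1) * Real.exp (-(x * y)) = Real.Gamma b * x ^ (-b) := by
    intro x hx
    rw [Real.integral_rpow_mul_exp_neg_mul_Ioi hb hx, Real.rpow_neg hx.le, one_div,
      Real.inv_rpow hx.le, mul_comm]
  have hmeas : Measurable
      (fun q : ℝ × ℝ ↦ (q.2 ^ (b - 1) * Real.exp (-(q.1 * q.2))) • k q.1) := by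
    fun_prop
  rw [integrable_prod_iff hmeas.aestronglyMeasurable]
  constructor
  · filter_upwards [ae_restrict_mem measurableSet_Ioi] with x hx
    have := integrableOn_rpow_mul_exp_neg_mul_rpow (p := 1) (s := b - 1) (b := x) (by linarith)
      one_pos hx
    refine Integrable.smul_const ?_ _
    simpa [IntegrableOn] using this
  · refine (hi.norm.const_mul (Real.Gamma b)).congr ?_
    filter_upwards [ae_restrict_mem measurableSet_Ioi] with x hx
    have hx' : (0 : ℝ) < x := hx
    have : ∫ y in Set.Ioi (0 : ℝ), ‖(y ^ (b - 1) * Real.exp (-(x * y))) • k x‖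
        = ∫ y in Set.Ioi (0 : ℝ), (y ^ (b - 1) * Real.exp (-(x * y))) * ‖k x‖ := by
      refine setIntegral_congr_fun measurableSet_Ioi fun y hy ↦ ?_
      have hy' : (0 : ℝ) < y := hy
      rw [norm_smul, Real.norm_of_nonneg (by positivity)]
    rw [integral_mul_const, hG x hx'] at this
    refine Eq.trans ?_ this.symm
    rw [norm_smul, Real.norm_of_nonneg (by positivity)]
    ring

theorem integrableOn_rpow_smul_laplace {b : ℝ} (hb : 0 < b) {k : ℝ → ℂ}
    (hk : Measurable k) (hi : IntegrableOn (fun x : ℝ ↦ (x ^ (-b) : ℝ) • k x) (Set.Ioi 0)) :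
    IntegrableOn (fun y : ℝ ↦ (y ^ (b - 1) : ℝ) • ∫ x in Set.Ioi (0 : ℝ),
      Real.exp (-(x * y)) • k x) (Set.Ioi 0) := by
  have := (integrable_prod_laplace hb hk hi).integral_prod_right
  refine this.congr (ae_of_all _ fun y ↦ ?_)
  simp only [mul_smul, integral_smul]

/-- Mellin transform of a Laplace transform. -/
theorem integral_rpow_smul_laplace {b : ℝ} (hb : 0 < b) {k : ℝ → ℂ}
    (hk : Measurable k) (hi : IntegrableOn (fun x : ℝ ↦ (x ^ (-b) : ℝ) • k x) (Set.Ioi 0)) :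
    ∫ y in Set.Ioi (0 : ℝ), (y ^ (b - 1) : ℝ) • ∫ x in Set.Ioi (0 : ℝ),
      Real.exp (-(x * y)) • k x = Real.Gamma b • ∫ x in Set.Ioi (0 : ℝ), (x ^ (-b) : ℝ) • k x := by
  have h := integral_integral_swap
    (f := fun x y : ℝ ↦ (y ^ (b - 1) * Real.exp (-(x * y))) • k x)
    (integrable_prod_laplace hb hk hi)
  simp only [mul_smul, integral_smul] at h
  rw [← h, ← integral_smul]
  refine setIntegral_congr_fun measurableSet_Ioi fun x hx ↦ ?_
  have hx' : (0 : ℝ) < x := hx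
  have hG := Real.integral_rpow_mul_exp_neg_mul_Ioi hb hx'
  simp only [← mul_smul]
  rw [integral_smul_const, hG, Real.rpow_neg hx'.le, one_div,
      Real.inv_rpow hx'.le, mul_comm]

theorem integral_exp_neg_mul_Ioi' {r : ℝ} (hr : 0 < r) :
    ∫ x in Set.Ioi (0 : ℝ), Real.exp (-(x * r)) = r⁻¹ := by
  have := Real.integral_rpow_mul_exp_neg_mul_Ioi one_pos hr
  simpa [mul_comm r] using this

/-- Apply the Mellin–Laplace formula to k(x) = e^(-xr), whose Laplace transform is 1/(y + r). The
outcome Γ(b) Γ(1-b) r^(b-1) is simplified by Euler's reflection formula. -/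
theorem integral_rpow_div_add_and_integrableOn {b r : ℝ} (hb : 0 < b) (hb1 : b < 1) (hr : 0 < r) :
    IntegrableOn (fun y : ℝ ↦ y ^ (b - 1) / (y + r)) (Set.Ioi 0) ∧
    ∫ y in Set.Ioi (0 : ℝ), y ^ (b - 1) / (y + r)
      = r ^ (b - 1) * (Real.pi / Real.sin (Real.pi * b)) := by
  have hL : ∀ y ∈ Set.Ioi (0 : ℝ), (y ^ (b - 1) : ℝ) • ∫ x in Set.Ioi (0 : ℝ),
      Real.exp (-(x * y)) • (Real.exp (-(x * r)) : ℂ) = ((y ^ (b - 1) / (y + r) : ℝ) : ℂ) := by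
    intro y hy
    have hy' : (0 : ℝ) < y := hy
    have : ∀ x : ℝ, Real.exp (-(x * y)) • (Real.exp (-(x * r)) : ℂ)
        = ((Real.exp (-(x * (y + r))) : ℝ) : ℂ) := by
      intro x
      rw [Complex.real_smul, ← Complex.ofReal_mul, ← Real.exp_add]
      congr 2; ring
    rw [integral_congr_ae (ae_of_all _ this), integral_complex_ofReal,
      integral_exp_neg_mul_Ioi' (by linarith), Complex.real_smul, ← Complex.ofReal_mul,
      div_eq_mul_inv]
  have hint := integrableOn_rpow_mul_exp_neg_mul_rpow (p := 1) (s := -b) (b := r) (by linarith)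
      one_pos hr
  have hi : IntegrableOn (fun x : ℝ ↦ (x ^ (-b) : ℝ) • (Real.exp (-(x * r)) : ℂ))
      (Set.Ioi 0) := by
    refine (Integrable.ofReal (𝕜 := ℂ) hint).congr (ae_of_all _ fun x ↦ ?_)
    simp [mul_comm r]
  have hm : Measurable fun x : ℝ ↦ (Real.exp (-(x * r)) : ℂ) := by fun_prop
  have h1 := integrableOn_rpow_smul_laplace hb hm hi
  have h2 := integral_rpow_smul_laplace hb hm hi
  constructor
  · have := (integrableOn_congr_fun hL measurableSet_Ioi).1 h1
    refine (Integrable.re this).congr (ae_of_all _ fun y ↦ ?_)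
    exact Complex.ofReal_re _
  · rw [setIntegral_congr_fun measurableSet_Ioi hL, integral_complex_ofReal] at h2
    have h3 : ∀ x : ℝ, (x ^ (-b) : ℝ) • (Real.exp (-(x * r)) : ℂ)
        = ((x ^ ((1 - b) - 1) * Real.exp (-(r * x)) : ℝ) : ℂ) := by
      intro x
      simp [mul_comm r]
    rw [integral_congr_ae (ae_of_all _ h3), integral_complex_ofReal,
      Real.integral_rpow_mul_exp_neg_mul_Ioi (by linarith) hr, Complex.real_smul,
      ← Complex.ofReal_mul, Complex.ofReal_inj] at h2
    rw [h2, ← Real.Gamma_mul_Gamma_one_sub, one_div, Real.inv_rpow hr.le, ← Real.rpow_neg hr.le]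
    rw [neg_sub]; ring

/-- The previous integral with b = c/2 and r = a², after the substitution y → y². -/
theorem integral_rpow_div_sq_add_sq_and_integrableOn {c a : ℝ} (hc : 0 < c) (hc2 : c < 2)
    (ha : a ≠ 0) :
    IntegrableOn (fun y : ℝ ↦ y ^ (c - 1) / (y ^ 2 + a ^ 2)) (Set.Ioi 0) ∧
    ∫ y in Set.Ioi (0 : ℝ), y ^ (c - 1) / (y ^ 2 + a ^ 2)
      = |a| ^ (c - 2) * (Real.pi / (2 * Real.sin (Real.pi / 2 * c))) := by
  have ha2 : 0 < a ^ 2 := by positivity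
  obtain ⟨h1, h2⟩ := integral_rpow_div_add_and_integrableOn (b := c / 2) (by linarith)
    (by linarith) ha2
  have hpt : ∀ y ∈ Set.Ioi (0 : ℝ), (|(2 : ℝ)| * y ^ ((2 : ℝ) - 1)) •
      ((y ^ (2 : ℝ)) ^ (c / 2 - 1) / (y ^ (2 : ℝ) + a ^ 2))
      = 2 * (y ^ (c - 1) / (y ^ 2 + a ^ 2)) := by
    intro y hy
    have hy' : (0 : ℝ) < y := hy
    rw [← Real.rpow_mul hy'.le, abs_two, smul_eq_mul]
    have : y ^ (c - 1) = y ^ ((2 : ℝ) - 1) * y ^ (2 * (c / 2 - 1)) := by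
      rw [← Real.rpow_add hy']; ring_nf
    rw [this, Real.rpow_two]; ring
  have h3 := integral_comp_rpow_Ioi (fun y : ℝ ↦ y ^ (c / 2 - 1) / (y + a ^ 2)) two_ne_zero
  have h4 := (integrableOn_Ioi_comp_rpow_iff (fun y : ℝ ↦ y ^ (c / 2 - 1) / (y + a ^ 2))
    two_ne_zero).2 h1
  rw [setIntegral_congr_fun measurableSet_Ioi hpt, integral_const_mul, h2] at h3
  constructor
  · have := (integrableOn_congr_fun hpt measurableSet_Ioi).1 h4
    have := this.const_mul (1 / 2 : ℝ)
    refine this.congr (ae_of_all _ fun x ↦ ?_)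
    simp
  · have : (a ^ 2) ^ (c / 2 - 1) = |a| ^ (c - 2) := by
      rw [← sq_abs, ← Real.rpow_two, ← Real.rpow_mul (abs_nonneg a)]; ring_nf
    rw [this] at h3
    have h5 : Real.pi * (c / 2) = Real.pi / 2 * c := by ring
    rw [h5] at h3
    rw [mul_comm 2 (Real.sin _), ← div_div, ← mul_div_assoc, ← h3]; ring

/-! ### The increment kernel and its integral against a power density -/

/-- The function `e ^ (i t x) - 1`. -/
noncomputable def expIncr (t x : ℝ) : ℂ := Complex.exp (Complex.I * (t * x : ℝ)) - 1

theorem norm_expIncr_le_abs (t x : ℝ) : ‖expIncr t x‖ ≤ |t| * |x| := by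
  rw [← abs_mul]
  exact Real.norm_exp_I_mul_ofReal_sub_one_le

theorem norm_expIncr_le_two (t x : ℝ) : ‖expIncr t x‖ ≤ 2 := by
  refine (norm_sub_le _ _).trans ?_
  rw [Complex.norm_exp_I_mul_ofReal, norm_one]
  norm_num

theorem continuous_expIncr (t : ℝ) : Continuous (expIncr t) := by
  unfold expIncr; fun_prop

theorem star_expIncr (t x : ℝ) : star (expIncr t x) = expIncr t (-x) := by
  simp [expIncr, ← Complex.exp_conj]

/-- The kernel `(e ^ (i t x) - 1) (e ^ (- i s x) - 1)`. -/
noncomputable def incrKernel (s t x : ℝ) : ℂ := expIncr t x * star (expIncr s x)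

theorem continuous_incrKernel (s t : ℝ) : Continuous (incrKernel s t) :=
  (continuous_expIncr t).mul (continuous_expIncr s).star

theorem norm_incrKernel_le_sq (s t x : ℝ) : ‖incrKernel s t x‖ ≤ |t| * |s| * x ^ 2 := by
  rw [incrKernel, norm_mul, norm_star]
  calc _ ≤ (|t| * |x|) * (|s| * |x|) := by
        gcongr <;> exact norm_expIncr_le_abs _ _
    _ = |t| * |s| * |x| ^ 2 := by ring
    _ = _ := by rw [sq_abs]

theorem norm_incrKernel_le_four (s t x : ℝ) : ‖incrKernel s t x‖ ≤ 4 := by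
  rw [incrKernel, norm_mul, norm_star]
  calc _ ≤ (2 : ℝ) * 2 := by
        gcongr <;> exact norm_expIncr_le_two _ _
    _ = _ := by norm_num

theorem star_incrKernel (s t x : ℝ) : star (incrKernel s t x) = incrKernel s t (-x) := by
  simp only [incrKernel, star_mul', star_expIncr]

/-- The kernel is O(x²) at the origin, which requires h < 2, and bounded at infinity, which requires
h > 0. -/
theorem integrableOn_incrKernel {h : ℝ} (h0 : 0 < h) (h2 : h < 2) (s t : ℝ) :
    IntegrableOn (fun x : ℝ ↦ (x ^ (-(1 + h)) : ℝ) • incrKernel s t x) (Set.Ioi 0) := by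
  have hmeas : Measurable fun x : ℝ ↦ (x ^ (-(1 + h)) : ℝ) • incrKernel s t x :=
    (measurable_id.pow_const _).smul (continuous_incrKernel s t).measurable
  rw [← Set.Ioc_union_Ioi_eq_Ioi zero_le_one, integrableOn_union]
  constructor
  · have h3 := (intervalIntegral.intervalIntegrable_rpow' (a := 0) (b := 1) (r := 1 - h)
      (by linarith)).const_mul (|t| * |s|)
    rw [intervalIntegrable_iff_integrableOn_Ioc_of_le zero_le_one] at h3
    refine Integrable.mono' h3 hmeas.aestronglyMeasurable ?_
    filter_upwards [ae_restrict_mem measurableSet_Ioc] with x hx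
    have hx0 : 0 < x := hx.1
    rw [norm_smul, Real.norm_of_nonneg (by positivity)]
    calc x ^ (-(1 + h)) * ‖incrKernel s t x‖ ≤ x ^ (-(1 + h)) * (|t| * |s| * x ^ 2) := by
          gcongr; exact norm_incrKernel_le_sq s t x
      _ = |t| * |s| * (x ^ (-(1 + h)) * x ^ (2 : ℝ)) := by rw [Real.rpow_two]; ring
      _ = _ := by rw [← Real.rpow_add hx0]; ring_nf
  · have h3 := (integrableOn_Ioi_rpow_of_lt (a := -(1 + h)) (by linarith) one_pos).mul_const 4
    refine Integrable.mono' h3 hmeas.aestronglyMeasurable ?_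
    filter_upwards [ae_restrict_mem measurableSet_Ioi] with x hx
    have hx0 : (0 : ℝ) < x := one_pos.trans hx
    rw [norm_smul, Real.norm_of_nonneg (by positivity)]
    gcongr
    exact norm_incrKernel_le_four s t x

/-- The integral of the increment kernel against the power spectral density
`x ^ (-1 - h)`. -/
noncomputable def spectralIntegral (h s t : ℝ) : ℂ :=
  ∫ x in Set.Ioi (0 : ℝ), (x ^ (-(1 + h)) : ℝ) • incrKernel s t x

theorem integrableOn_exp_smul_exp_I (y θ : ℝ) (hy : 0 < y) :
    IntegrableOn (fun x : ℝ ↦ Real.exp (-(x * y)) • Complex.exp (Complex.I * (θ * x : ℝ)))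
      (Set.Ioi 0) ∧
    ∫ x in Set.Ioi (0 : ℝ), Real.exp (-(x * y)) • Complex.exp (Complex.I * (θ * x : ℝ))
      = ((y / (y ^ 2 + θ ^ 2) : ℝ) : ℂ) + (θ / (y ^ 2 + θ ^ 2) : ℝ) * Complex.I := by
  have hre : (-(y : ℂ) + Complex.I * θ).re < 0 := by simpa using hy
  have hpt : ∀ x : ℝ, Real.exp (-(x * y)) • Complex.exp (Complex.I * (θ * x : ℝ))
      = Complex.exp ((-(y : ℂ) + Complex.I * θ) * x) := by
    intro x
    rw [Complex.real_smul, Complex.ofReal_exp, ← Complex.exp_add]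
    push_cast
    congr 1; ring
  simp only [hpt]
  refine ⟨integrableOn_exp_mul_complex_Ioi hre 0, ?_⟩
  rw [integral_exp_mul_complex_Ioi hre]
  have h1 : (-(y : ℂ) + Complex.I * θ) ≠ 0 := by
    intro h; rw [h] at hre; simp at hre
  have h2 : ((y : ℂ) ^ 2 + (θ : ℂ) ^ 2) ≠ 0 := by
    have : y ^ 2 + θ ^ 2 ≠ 0 := by positivity
    exact_mod_cast this
  simp only [Complex.ofReal_zero, mul_zero, Complex.exp_zero]
  push_cast
  field_simp
  linear_combination (-(θ : ℂ) ^ 2) * Complex.I_sq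

/-- The constant 1 is kept as an exponential of frequency 0, so that one Laplace formula serves all
four terms; it is the source of y / y² below. -/
theorem incrKernel_eq (s t x : ℝ) : incrKernel s t x
    = Complex.exp (Complex.I * ((t - s) * x : ℝ)) - Complex.exp (Complex.I * (t * x : ℝ))
      - Complex.exp (Complex.I * ((-s) * x : ℝ)) + Complex.exp (Complex.I * (0 * x : ℝ)) := by
  have : Complex.exp (Complex.I * ((t - s) * x : ℝ))
      = Complex.exp (Complex.I * (t * x : ℝ)) * Complex.exp (Complex.I * ((-s) * x : ℝ)) := by
    rw [← Complex.exp_add]; push_cast; congr 1; ring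
  rw [incrKernel, star_expIncr, expIncr, expIncr, this]
  simp only [mul_neg, neg_mul, zero_mul, Complex.ofReal_zero, mul_zero, Complex.exp_zero]
  ring

/-- Laplace transform of the increment kernel. -/
theorem laplace_incrKernel (s t y : ℝ) (hy : 0 < y) :
    ∫ x in Set.Ioi (0 : ℝ), Real.exp (-(x * y)) • incrKernel s t x
      = ((y / (y ^ 2 + (t - s) ^ 2) - y / (y ^ 2 + t ^ 2) - y / (y ^ 2 + s ^ 2) + y / y ^ 2 : ℝ) : ℂ)
        + (((t - s) / (y ^ 2 + (t - s) ^ 2) - t / (y ^ 2 + t ^ 2) + s / (y ^ 2 + s ^ 2) : ℝ) : ℂ)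
          * Complex.I := by
  have i1 := integrableOn_exp_smul_exp_I y (t - s) hy
  have i2 := integrableOn_exp_smul_exp_I y t hy
  have i3 := integrableOn_exp_smul_exp_I y (-s) hy
  have i4 := integrableOn_exp_smul_exp_I y 0 hy
  simp only [incrKernel_eq, smul_add, smul_sub]
  rw [integral_add (by exact (i1.1.sub i2.1).sub i3.1) i4.1,
    integral_sub (by exact i1.1.sub i2.1) i3.1, integral_sub i1.1 i2.1, i1.2, i2.2, i3.2, i4.2, neg_sq]
  push_cast
  ring_nf

/-- The Mellin–Laplace formula with b = 1 + h. Integrability of the imaginary part is recorded for h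
= 1, where its three terms need not be integrable separately. -/
theorem integrableOn_rpow_mul_laplace_re_im {h : ℝ} (h0 : 0 < h) (h2 : h < 2) (s t : ℝ) :
    (IntegrableOn (fun y : ℝ ↦ y ^ h *
      ((t - s) / (y ^ 2 + (t - s) ^ 2) - t / (y ^ 2 + t ^ 2) + s / (y ^ 2 + s ^ 2)))
      (Set.Ioi 0)) ∧
    Real.Gamma (h + 1) * (spectralIntegral h s t).re = ∫ y in Set.Ioi (0 : ℝ), y ^ h *
      (y / (y ^ 2 + (t - s) ^ 2) - y / (y ^ 2 + t ^ 2) - y / (y ^ 2 + s ^ 2) + y / y ^ 2) ∧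
    Real.Gamma (h + 1) * (spectralIntegral h s t).im = ∫ y in Set.Ioi (0 : ℝ), y ^ h *
      ((t - s) / (y ^ 2 + (t - s) ^ 2) - t / (y ^ 2 + t ^ 2) + s / (y ^ 2 + s ^ 2)) := by
  have hb : 0 < 1 + h := by linarith
  have hm := (continuous_incrKernel s t).measurable
  have hi := integrableOn_incrKernel h0 h2 s t
  have e1 := integrableOn_rpow_smul_laplace hb hm hi
  have e2 := integral_rpow_smul_laplace hb hm hi
  rw [add_sub_cancel_left, add_comm] at e2
  rw [add_sub_cancel_left] at e1
  have hpt : ∀ y ∈ Set.Ioi (0 : ℝ), (y ^ h : ℝ) • ∫ x in Set.Ioi (0 : ℝ),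
      Real.exp (-(x * y)) • incrKernel s t x = (y ^ h : ℝ) • (_ : ℂ) :=
    fun y hy ↦ by rw [laplace_incrKernel s t y hy]
  have e1' := (integrableOn_congr_fun hpt measurableSet_Ioi).1 e1
  rw [setIntegral_congr_fun measurableSet_Ioi hpt] at e2
  have hre := Integrable.re e1'
  have him := Integrable.im e1'
  refine ⟨him.congr (ae_of_all _ fun y ↦ ?_), ?_, ?_⟩
  · simp only [RCLike.im_to_complex, Complex.smul_im, Complex.add_im, Complex.ofReal_im,
      Complex.mul_I_im, Complex.ofReal_re, zero_add, smul_eq_mul]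
  · have := congrArg Complex.re e2
    rw [Complex.smul_re, smul_eq_mul] at this
    rw [spectralIntegral, add_comm 1 h, ← this, ← RCLike.re_to_complex, ← integral_re e1']
    refine integral_congr_ae (ae_of_all _ fun y ↦ ?_)
    simp only [RCLike.re_to_complex, Complex.smul_re, Complex.add_re, Complex.ofReal_im,
      Complex.mul_I_re, Complex.ofReal_re, add_zero, smul_eq_mul, neg_zero]
  · have := congrArg Complex.im e2
    rw [Complex.smul_im, smul_eq_mul] at this
    rw [spectralIntegral, add_comm 1 h, ← this, ← RCLike.im_to_complex, ← integral_im e1']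
    refine integral_congr_ae (ae_of_all _ fun y ↦ ?_)
    simp only [RCLike.im_to_complex, Complex.smul_im, Complex.add_im, Complex.ofReal_im,
      Complex.mul_I_im, Complex.ofReal_re, zero_add, smul_eq_mul]

theorem spectralIntegral_re {h : ℝ} (h0 : 0 < h) (h2 : h < 2) (s t : ℝ) :
    Real.Gamma (h + 1) * (spectralIntegral h s t).re
      = Real.pi / (2 * Real.sin (Real.pi / 2 * h)) * (|s| ^ h + |t| ^ h - |t - s| ^ h) := by
  rw [(integrableOn_rpow_mul_laplace_re_im h0 h2 s t).2.1]
  have key : ∀ a : ℝ, IntegrableOn (fun y : ℝ ↦ a ^ 2 * (y ^ (h - 1) / (y ^ 2 + a ^ 2)))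
      (Set.Ioi 0) ∧
      ∫ y in Set.Ioi (0 : ℝ), a ^ 2 * (y ^ (h - 1) / (y ^ 2 + a ^ 2))
        = Real.pi / (2 * Real.sin (Real.pi / 2 * h)) * |a| ^ h := by
    intro a
    rcases eq_or_ne a 0 with rfl | ha
    · simp [Real.zero_rpow h0.ne']
    · obtain ⟨h1, h2⟩ := integral_rpow_div_sq_add_sq_and_integrableOn h0 h2 ha
      refine ⟨h1.const_mul _, ?_⟩
      rw [integral_const_mul, h2, ← sq_abs, ← mul_assoc, ← Real.rpow_two,
        ← Real.rpow_add (abs_pos.2 ha)]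
      ring_nf
  have hpt : ∀ y ∈ Set.Ioi (0 : ℝ), y ^ h *
      (y / (y ^ 2 + (t - s) ^ 2) - y / (y ^ 2 + t ^ 2) - y / (y ^ 2 + s ^ 2) + y / y ^ 2)
      = s ^ 2 * (y ^ (h - 1) / (y ^ 2 + s ^ 2)) + t ^ 2 * (y ^ (h - 1) / (y ^ 2 + t ^ 2))
        - (t - s) ^ 2 * (y ^ (h - 1) / (y ^ 2 + (t - s) ^ 2)) := by
    intro y hy
    have hy' : (0 : ℝ) < y := hy
    have e : y ^ h = y ^ (h - 1) * y := by
      rw [← Real.rpow_add_one hy'.ne']; ring_nf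
    -- Removing 1/y from each fraction costs nothing, since the four coefficients 1, -1, -1, 1 sum
    -- to zero; the remainders converge separately for 0 < h < 2.
    have h1 : ∀ a : ℝ, y / (y ^ 2 + a ^ 2) = (1 - a ^ 2 / (y ^ 2 + a ^ 2)) / y := by
      intro a
      have : y ^ 2 + a ^ 2 ≠ 0 := by positivity
      field_simp
      ring
    have h2 : y / y ^ 2 = 1 / y := by field_simp
    rw [h1, h1, h1, h2, e]
    field_simp
    ring
  rw [setIntegral_congr_fun measurableSet_Ioi hpt,
    integral_sub (by exact (key s).1.add (key t).1) (key (t - s)).1,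
    integral_add (key s).1 (key t).1, (key s).2, (key t).2, (key _).2]
  ring

theorem sign_mul_abs_rpow {a : ℝ} (ha : a ≠ 0) (h : ℝ) :
    Real.sign a * |a| ^ h = a * |a| ^ (h - 1) := by
  have : |a| ^ h = |a| * |a| ^ (h - 1) := by
    rw [mul_comm, ← Real.rpow_add_one (abs_pos.2 ha).ne']; ring_nf
  rw [this, ← mul_assoc]
  congr 1
  rcases lt_or_gt_of_ne ha with h1 | h1
  · rw [Real.sign_of_neg h1, abs_of_neg h1]; ring
  · rw [Real.sign_of_pos h1, abs_of_pos h1]; ring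

theorem spectralIntegral_im_of_lt_one {h : ℝ} (h0 : 0 < h) (h1 : h < 1) (s t : ℝ) :
    Real.Gamma (h + 1) * (spectralIntegral h s t).im
      = Real.pi / (2 * Real.cos (Real.pi / 2 * h)) * (Real.sign (t - s) * |t - s| ^ h
        - Real.sign t * |t| ^ h + Real.sign s * |s| ^ h) := by
  rw [(integrableOn_rpow_mul_laplace_re_im h0 (by linarith) s t).2.2]
  have key : ∀ a : ℝ, IntegrableOn (fun y : ℝ ↦ a * (y ^ h / (y ^ 2 + a ^ 2))) (Set.Ioi 0) ∧
      ∫ y in Set.Ioi (0 : ℝ), a * (y ^ h / (y ^ 2 + a ^ 2))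
        = Real.pi / (2 * Real.cos (Real.pi / 2 * h)) * (Real.sign a * |a| ^ h) := by
    intro a
    rcases eq_or_ne a 0 with rfl | ha
    · simp
    · obtain ⟨h3, h4⟩ := integral_rpow_div_sq_add_sq_and_integrableOn (c := h + 1)
        (by linarith) (by linarith) ha
      rw [add_sub_cancel_right] at h3 h4
      refine ⟨h3.const_mul _, ?_⟩
      have e : Real.pi / 2 * (h + 1) = Real.pi / 2 * h + Real.pi / 2 := by ring
      rw [integral_const_mul, h4, sign_mul_abs_rpow ha, e, Real.sin_add_pi_div_two]
      ring_nf
  have hpt : ∀ y : ℝ, y ^ h *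
      ((t - s) / (y ^ 2 + (t - s) ^ 2) - t / (y ^ 2 + t ^ 2) + s / (y ^ 2 + s ^ 2))
      = (t - s) * (y ^ h / (y ^ 2 + (t - s) ^ 2)) - t * (y ^ h / (y ^ 2 + t ^ 2))
        + s * (y ^ h / (y ^ 2 + s ^ 2)) := by
    intro y; ring
  simp only [hpt]
  rw [integral_add (by exact (key (t - s)).1.sub (key t).1) (key s).1,
    integral_sub (key (t - s)).1 (key t).1, (key s).2, (key t).2, (key _).2]
  ring

/-- For h > 1 the terms a y^h / (y² + a²) with a ≠ 0 diverge at infinity. Their leading parts a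
y^(h-2) cancel because (t - s) - t + s = 0, and the remainders a³ y^(h-2) / (y² + a²) are
integrable. The sign of the cosine comes from sin(x - π/2) = -cos x. -/
theorem spectralIntegral_im_of_one_lt {h : ℝ} (h1 : 1 < h) (h2 : h < 2) (s t : ℝ) :
    Real.Gamma (h + 1) * (spectralIntegral h s t).im
      = Real.pi / (2 * Real.cos (Real.pi / 2 * h)) * (Real.sign (t - s) * |t - s| ^ h
        - Real.sign t * |t| ^ h + Real.sign s * |s| ^ h) := by
  rw [(integrableOn_rpow_mul_laplace_re_im (by linarith) h2 s t).2.2]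
  have key : ∀ a : ℝ, IntegrableOn (fun y : ℝ ↦ a ^ 3 * (y ^ (h - 2) / (y ^ 2 + a ^ 2)))
      (Set.Ioi 0) ∧
      ∫ y in Set.Ioi (0 : ℝ), a ^ 3 * (y ^ (h - 2) / (y ^ 2 + a ^ 2))
        = -(Real.pi / (2 * Real.cos (Real.pi / 2 * h))) * (Real.sign a * |a| ^ h) := by
    intro a
    rcases eq_or_ne a 0 with rfl | ha
    · simp
    · obtain ⟨h3, h4⟩ := integral_rpow_div_sq_add_sq_and_integrableOn (c := h - 1)
        (by linarith) (by linarith) ha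
      have e2 : h - 1 - 1 = h - 2 := by ring
      rw [e2] at h3 h4
      refine ⟨h3.const_mul _, ?_⟩
      have e : Real.pi / 2 * (h - 1) = Real.pi / 2 * h - Real.pi / 2 := by ring
      have e3 : |a| ^ (h - 1) = a ^ 2 * |a| ^ (h - 1 - 2) := by
        rw [← sq_abs, ← Real.rpow_two, ← Real.rpow_add (abs_pos.2 ha)]; ring_nf
      rw [integral_const_mul, h4, sign_mul_abs_rpow ha, e, Real.sin_sub_pi_div_two, e3]
      rw [mul_neg, div_neg]
      ring
  have hpt : ∀ y ∈ Set.Ioi (0 : ℝ), y ^ h *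
      ((t - s) / (y ^ 2 + (t - s) ^ 2) - t / (y ^ 2 + t ^ 2) + s / (y ^ 2 + s ^ 2))
      = t ^ 3 * (y ^ (h - 2) / (y ^ 2 + t ^ 2)) - s ^ 3 * (y ^ (h - 2) / (y ^ 2 + s ^ 2))
        - (t - s) ^ 3 * (y ^ (h - 2) / (y ^ 2 + (t - s) ^ 2)) := by
    intro y hy
    have hy' : (0 : ℝ) < y := hy
    have e : y ^ h = y ^ (h - 2) * y ^ 2 := by
      rw [← Real.rpow_two, ← Real.rpow_add hy']; ring_nf
    have h1 : ∀ a : ℝ, a / (y ^ 2 + a ^ 2) = (a - a ^ 3 / (y ^ 2 + a ^ 2)) / y ^ 2 := by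
      intro a
      have : y ^ 2 + a ^ 2 ≠ 0 := by positivity
      field_simp
      ring
    rw [h1, h1, h1, e]
    field_simp
    ring
  rw [setIntegral_congr_fun measurableSet_Ioi hpt,
    integral_sub (by exact (key t).1.sub (key s).1) (key (t - s)).1,
    integral_sub (key t).1 (key s).1, (key s).2, (key t).2, (key _).2]
  ring

theorem spectralIntegral_im {h : ℝ} (h0 : 0 < h) (h2 : h < 2) (h1 : h ≠ 1) (s t : ℝ) :
    Real.Gamma (h + 1) * (spectralIntegral h s t).im
      = Real.pi / (2 * Real.cos (Real.pi / 2 * h)) * (Real.sign (t - s) * |t - s| ^ h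
        - Real.sign t * |t| ^ h + Real.sign s * |s| ^ h) := by
  rcases lt_or_gt_of_ne h1 with h | h
  · exact spectralIntegral_im_of_lt_one h0 h s t
  · exact spectralIntegral_im_of_one_lt h h2 s t

theorem hasDerivAt_half_mul_log_sq_add_sq (a : ℝ) {y : ℝ} (hy : 0 < y) :
    HasDerivAt (fun y : ℝ ↦ a / 2 * Real.log (y ^ 2 + a ^ 2)) (y * (a / (y ^ 2 + a ^ 2))) y := by
  have h1 : y ^ 2 + a ^ 2 ≠ 0 := by positivity
  have := (((hasDerivAt_pow 2 y).add_const (a ^ 2)).log h1).const_mul (a / 2)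
  convert! this using 1
  simp; ring

theorem continuousAt_half_mul_log_sq_add_sq_zero (a : ℝ) :
    ContinuousAt (fun y : ℝ ↦ a / 2 * Real.log (y ^ 2 + a ^ 2)) 0 := by
  rcases eq_or_ne a 0 with rfl | ha
  · simpa using continuousAt_const
  · have : (0 : ℝ) ^ 2 + a ^ 2 ≠ 0 := by positivity
    fun_prop (disch := assumption)

theorem half_mul_log_sq (a : ℝ) : a / 2 * Real.log (0 ^ 2 + a ^ 2) = a * Real.log |a| := by
  rw [Real.log_abs]
  simp [Real.log_pow]
  ring

theorem tendsto_half_mul_log_sq_add_sq_atTop (a : ℝ) :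
    Tendsto (fun y : ℝ ↦ a / 2 * Real.log (y ^ 2 + a ^ 2) - a * Real.log y) atTop (𝓝 0) := by
  have h1 : Tendsto (fun y : ℝ ↦ 1 + a ^ 2 * (y⁻¹) ^ 2) atTop (𝓝 (1 + a ^ 2 * 0 ^ 2)) :=
    ((tendsto_inv_atTop_zero.pow 2).const_mul _).const_add _
  have h2 := (h1.log (by norm_num)).const_mul (a / 2)
  simp only [ne_eq, OfNat.ofNat_ne_zero, not_false_eq_true, zero_pow, mul_zero, add_zero,
    Real.log_one] at h2
  refine h2.congr' ?_
  filter_upwards [eventually_gt_atTop 0] with y hy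
  have : y ^ 2 + a ^ 2 = y ^ 2 * (1 + a ^ 2 * (y⁻¹) ^ 2) := by field_simp
  rw [this, Real.log_mul (by positivity) (by positivity), Real.log_pow]
  push_cast
  ring

/-- At the borderline exponent an explicit primitive is used. Its growth a log y at infinity cancels
because (t - s) - t + s = 0, and at the origin each term equals a log|a|. The convention 0 log 0 = 0
agrees with `Real.log 0 = 0`. -/
theorem spectralIntegral_one_im (s t : ℝ) :
    (spectralIntegral 1 s t).im
      = t * Real.log |t| - s * Real.log |s| - (t - s) * Real.log |t - s| := by
  obtain ⟨h1, -, h3⟩ := integrableOn_rpow_mul_laplace_re_im one_pos one_lt_two s t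
  have hG : Real.Gamma (1 + 1) = 1 := by norm_num
  rw [hG, one_mul] at h3
  rw [h3]
  have hd : ∀ y ∈ Set.Ioi (0 : ℝ), HasDerivAt (fun y : ℝ ↦
      (t - s) / 2 * Real.log (y ^ 2 + (t - s) ^ 2) - t / 2 * Real.log (y ^ 2 + t ^ 2)
        + s / 2 * Real.log (y ^ 2 + s ^ 2)) (y ^ (1 : ℝ) *
      ((t - s) / (y ^ 2 + (t - s) ^ 2) - t / (y ^ 2 + t ^ 2) + s / (y ^ 2 + s ^ 2))) y := by
    intro y hy
    have := ((hasDerivAt_half_mul_log_sq_add_sq (t - s) hy).sub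
      (hasDerivAt_half_mul_log_sq_add_sq t hy)).add (hasDerivAt_half_mul_log_sq_add_sq s hy)
    convert! this using 1
    rw [Real.rpow_one]; ring
  have hz : ContinuousAt (fun y : ℝ ↦
      (t - s) / 2 * Real.log (y ^ 2 + (t - s) ^ 2) - t / 2 * Real.log (y ^ 2 + t ^ 2)
        + s / 2 * Real.log (y ^ 2 + s ^ 2)) 0 := ((continuousAt_half_mul_log_sq_add_sq_zero (t - s)).sub
      (continuousAt_half_mul_log_sq_add_sq_zero t)).add
      (continuousAt_half_mul_log_sq_add_sq_zero s)
  have ht : Tendsto (fun y : ℝ ↦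
      (t - s) / 2 * Real.log (y ^ 2 + (t - s) ^ 2) - t / 2 * Real.log (y ^ 2 + t ^ 2)
        + s / 2 * Real.log (y ^ 2 + s ^ 2)) atTop (𝓝 0) := by
    have := ((tendsto_half_mul_log_sq_add_sq_atTop (t - s)).sub
      (tendsto_half_mul_log_sq_add_sq_atTop t)).add (tendsto_half_mul_log_sq_add_sq_atTop s)
    simp only [sub_zero, add_zero] at this
    refine this.congr fun y ↦ ?_
    ring
  rw [integral_Ioi_of_hasDerivAt_of_tendsto hz.continuousWithinAt hd h1 ht]
  simp only [half_mul_log_sq]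
  ring

/-! ### Gaussian processes with prescribed covariance -/

/-- Every positive semidefinite real kernel is a Gram kernel in a Hilbert space. -/
theorem exists_gram {T : Type} {K : Matrix T T ℝ} (hK : K.PosSemidef) :
    ∃ (ι : Type) (v : T → lp (fun _ : ι ↦ ℝ) 2), ∀ s t, inner ℝ (v s) (v t) = K s t := by
  classical
  -- Reproducing kernels are operator-valued here, so each scalar becomes a multiple of the identity
  -- of ℝ. A Hilbert basis then carries the kernel functions isometrically into ℓ².
  let K' : Matrix T T (ℝ →L[ℝ] ℝ) := Matrix.of fun s t ↦ K s t • ContinuousLinearMap.id ℝ ℝ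
  have hK' : K'.PosSemidef := by
    have htfae := (RKHS.posSemidef_tfae (𝕜 := ℝ) (K := K')).out 0 2
    rw [htfae]
    refine ⟨?_, fun w ↦ ?_⟩
    · ext s t
      have := hK.1.apply s t
      simp only [star_trivial] at this
      simp [K', Matrix.conjTranspose_apply, this, star_smul]
      rw [show ContinuousLinearMap.id ℝ ℝ = 1 from rfl, star_one]
      simp
    · have := hK.2 w
      refine this.trans_eq ?_
      simp [K', Finsupp.sum]
      rw [Finset.sum_comm]
      refine Finset.sum_congr rfl fun i _ ↦ Finset.sum_congr rfl fun j _ ↦ ?_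
      ring
  have : Fact K'.PosSemidef := ⟨hK'⟩
  obtain ⟨w, b, -⟩ := exists_hilbertBasis ℝ (RKHS.OfKernel K')
  refine ⟨w, fun t ↦ b.repr (RKHS.kerFun (RKHS.OfKernel K') t 1), fun s t ↦ ?_⟩
  rw [LinearIsometryEquiv.inner_map_map, ← RKHS.kernel_inner, RKHS.OfKernel.kernel_ofKernel]
  have := hK.1.apply s t
  simpa [K'] using this

section CenteredGaussian

variable {Ω : Type*} {mΩ : MeasurableSpace Ω} {P : Measure Ω}

/-- Combine |e^(iu) - e^(iv)| ≤ |u - v| with the bound of the L¹ norm by the L² norm on a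
probability space. -/
theorem norm_integral_exp_sub_le [IsProbabilityMeasure P] (t : ℝ) (f g : Lp ℝ 2 P) :
    ‖∫ ω, Complex.exp (t * f ω * Complex.I) ∂P - ∫ ω, Complex.exp (t * g ω * Complex.I) ∂P‖
      ≤ |t| * ‖f - g‖ := by
  have hi : ∀ f : Lp ℝ 2 P, Integrable (fun ω ↦ Complex.exp (t * f ω * Complex.I)) P := by
    intro f
    have hf := (Lp.aestronglyMeasurable f).aemeasurable
    refine Integrable.of_bound (C := 1) ?_ (ae_of_all _ fun ω ↦ ?_)
    · have : AEMeasurable (fun ω ↦ Complex.exp (t * f ω * Complex.I)) P := by fun_prop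
      exact this.aestronglyMeasurable
    · rw [← Complex.ofReal_mul, Complex.norm_exp_ofReal_mul_I]
  have hfg : Integrable (f - g : Lp ℝ 2 P) P := (Lp.memLp (f - g)).integrable one_le_two
  rw [← integral_sub (hi f) (hi g)]
  have h1 : ∀ᵐ ω ∂P, ‖Complex.exp (t * f ω * Complex.I) - Complex.exp (t * g ω * Complex.I)‖
      ≤ |t| * ‖(f - g : Lp ℝ 2 P) ω‖ := by
    filter_upwards [Lp.coeFn_sub f g] with ω hω
    have e : Complex.exp (t * f ω * Complex.I) - Complex.exp (t * g ω * Complex.I)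
        = Complex.exp ((t * g ω : ℝ) * Complex.I)
          * (Complex.exp (Complex.I * (t * (f ω - g ω) : ℝ)) - 1) := by
      rw [mul_sub, ← Complex.exp_add, mul_one]
      push_cast
      congr 2; ring
    rw [e, norm_mul, Complex.norm_exp_ofReal_mul_I, one_mul, hω, Pi.sub_apply, ← Real.norm_eq_abs,
      ← norm_mul]
    exact Real.norm_exp_I_mul_ofReal_sub_one_le
  refine (norm_integral_le_of_norm_le (hfg.norm.const_mul |t|) h1).trans ?_
  rw [integral_const_mul]
  gcongr
  rw [integral_norm_eq_lintegral_enorm hfg.1, ← eLpNorm_one_eq_lintegral_enorm, Lp.norm_def]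
  exact ENNReal.toReal_mono (Lp.eLpNorm_ne_top _)
    (eLpNorm_le_eLpNorm_of_exponent_le one_le_two hfg.1)

theorem map_eq_gaussianReal_iff_charFun [IsProbabilityMeasure P] (f : Lp ℝ 2 P) :
    P.map f = gaussianReal 0 (‖f‖₊ ^ 2) ↔ ∀ t : ℝ,
      ∫ ω, Complex.exp (t * f ω * Complex.I) ∂P = Complex.exp (-(‖f‖ ^ 2 * t ^ 2 / 2)) := by
  have hf := (Lp.aestronglyMeasurable f).aemeasurable
  have : IsProbabilityMeasure (P.map f) := Measure.isProbabilityMeasure_map hf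
  have h1 : ∀ t : ℝ, charFun (P.map f) t = ∫ ω, Complex.exp (t * f ω * Complex.I) ∂P := by
    intro t
    rw [charFun_apply_real, integral_map hf (by fun_prop)]
  have h2 : ∀ t : ℝ, charFun (gaussianReal 0 (‖f‖₊ ^ 2)) t
      = Complex.exp (-(‖f‖ ^ 2 * t ^ 2 / 2)) := by
    intro t
    rw [charFun_gaussianReal]
    simp
  constructor
  · intro h t
    rw [← h1, h, h2]
  · intro h
    refine Measure.ext_of_charFun (funext fun t ↦ ?_)
    rw [h1, h2, h]

/-- At each t both characteristic functions are continuous in f for the L² norm. This carries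
Gaussianity from finite sums to L² limits. -/
theorem isClosed_setOf_map_eq_gaussianReal [IsProbabilityMeasure P] :
    IsClosed {f : Lp ℝ 2 P | P.map f = gaussianReal 0 (‖f‖₊ ^ 2)} := by
  simp only [map_eq_gaussianReal_iff_charFun, Set.ofPred_forall]
  refine isClosed_iInter fun t ↦ isClosed_eq ?_ (by fun_prop)
  have : LipschitzWith ‖t‖₊ fun f : Lp ℝ 2 P ↦ ∫ ω, Complex.exp (t * f ω * Complex.I) ∂P := by
    refine LipschitzWith.of_dist_le_mul fun f g ↦ ?_
    rw [dist_eq_norm, dist_eq_norm]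
    exact norm_integral_exp_sub_le t f g
  exact this.continuous

theorem coeFn_sum_Lp {α : Type*} (s : Finset α) (g : α → Lp ℝ 2 P) :
    (∑ i ∈ s, g i : Lp ℝ 2 P) =ᵐ[P] fun ω ↦ ∑ i ∈ s, g i ω := by
  classical
  induction s using Finset.induction_on with
  | empty => simp only [Finset.sum_empty]; exact Lp.coeFn_zero ℝ 2 P
  | insert a s ha ih =>
    simp only [Finset.sum_insert ha]
    filter_upwards [ih, Lp.coeFn_add (g a) (∑ i ∈ s, g i)] with ω h1 h2
    rw [h2, Pi.add_apply, h1]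

theorem map_eq_gaussianReal_of_hasGaussianLaw {f : Lp ℝ 2 P} (hf : HasGaussianLaw f P)
    (h0 : ∫ ω, f ω ∂P = 0) : P.map f = gaussianReal 0 (‖f‖₊ ^ 2) := by
  rw [hf.map_eq_gaussianReal, h0]
  congr 1
  rw [variance_of_integral_eq_zero hf.aemeasurable h0]
  have : ∫ ω, (f ω) ^ 2 ∂P = ‖f‖ ^ 2 := by
    rw [← real_inner_self_eq_norm_sq, L2.inner_def]
    simp [sq]
  ext
  simp [this]

end CenteredGaussian

/-- The isonormal Gaussian process over `ℓ²(ι)`. -/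
theorem exists_isonormal (ι : Type) :
    ∃ (Ω : Type) (_ : MeasurableSpace Ω) (P : Measure Ω) (_ : IsProbabilityMeasure P)
      (W : lp (fun _ : ι ↦ ℝ) 2 →ₗᵢ[ℝ] Lp ℝ 2 P),
      ∀ f, P.map (W f) = gaussianReal 0 (‖f‖₊ ^ 2) := by
  classical
  -- The coordinates under a product of standard Gaussians are independent, hence orthonormal in L²,
  -- and f is sent to the series ∑ f i • ξ i.
  let P : Measure (ι → ℝ) := Measure.infinitePi fun _ ↦ gaussianReal 0 1
  have hmap : ∀ i, P.map (fun x ↦ x i) = gaussianReal 0 1 :=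
    fun i ↦ Measure.infinitePi_map_eval _ i
  have hlaw : ∀ i, HasGaussianLaw (fun x : ι → ℝ ↦ x i) P := fun i ↦ ⟨by
    rw [hmap]; infer_instance⟩
  have hmean : ∀ i, ∫ x, x i ∂P = 0 := by
    intro i
    have := integral_map (μ := P) (φ := fun x : ι → ℝ ↦ x i) (measurable_pi_apply i).aemeasurable
      (f := fun y : ℝ ↦ y) (by fun_prop)
    rw [← this, hmap, integral_id_gaussianReal]
  have hvar : ∀ i, Var[fun x : ι → ℝ ↦ x i; P] = 1 := by
    intro i
    have := variance_map (μ := P) (Y := fun x : ι → ℝ ↦ x i) (X := fun y : ℝ ↦ y)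
      (by fun_prop) (measurable_pi_apply i).aemeasurable
    rw [hmap, variance_fun_id_gaussianReal] at this
    exact this.symm
  have hL2 : ∀ i, MemLp (fun x : ι → ℝ ↦ x i) 2 P := fun i ↦ (hlaw i).memLp_two
  have hind : iIndepFun (fun (i : ι) (x : ι → ℝ) ↦ x i) P :=
    iIndepFun_infinitePi (X := fun _ ↦ id) fun _ ↦ measurable_id
  let ξ : ι → Lp ℝ 2 P := fun i ↦ (hL2 i).toLp _
  have hξ : ∀ i, ξ i =ᵐ[P] fun x ↦ x i := fun i ↦ (hL2 i).coeFn_toLp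
  have hcov : ∀ i j, inner ℝ (ξ i) (ξ j) = cov[fun x : ι → ℝ ↦ x i, fun x ↦ x j; P] := by
    intro i j
    rw [L2.inner_def, covariance]
    refine integral_congr_ae ?_
    filter_upwards [hξ i, hξ j] with x h1 h2
    simp [h1, h2, hmean, mul_comm]
  have hon : Orthonormal ℝ ξ := by
    rw [orthonormal_iff_ite]
    intro i j
    rw [hcov]
    split_ifs with h
    · subst h
      rw [covariance_self (measurable_pi_apply i).aemeasurable, hvar]
    · exact (hind.indepFun h).covariance_eq_zero (hL2 i) (hL2 j)
  refine ⟨ι → ℝ, inferInstance, P, inferInstance, hon.orthogonalFamily.linearIsometry,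
    fun f ↦ ?_⟩
  have hsum := hon.orthogonalFamily.hasSum_linearIsometry f
  have hfin : ∀ F : Finset ι, P.map (∑ i ∈ F, LinearIsometry.toSpanSingleton ℝ (Lp ℝ 2 P)
      (hon.1 i) (f i) : Lp ℝ 2 P)
      = gaussianReal 0 (‖∑ i ∈ F, LinearIsometry.toSpanSingleton ℝ (Lp ℝ 2 P)
      (hon.1 i) (f i)‖₊ ^ 2) := by
    intro F
    have hae : (∑ i ∈ F, LinearIsometry.toSpanSingleton ℝ (Lp ℝ 2 P) (hon.1 i) (f i) : Lp ℝ 2 P)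
        =ᵐ[P] fun x ↦ ∑ i : F, f i * x i := by
      have h1 : ∀ᵐ x ∂P, ∀ i : F, (f i • ξ i : Lp ℝ 2 P) x = f i * x i := by
        rw [ae_all_iff]
        intro i
        filter_upwards [Lp.coeFn_smul (f i) (ξ i), hξ i] with x h1 h2
        rw [h1, Pi.smul_apply, h2, smul_eq_mul]
      filter_upwards [h1, coeFn_sum_Lp F fun i ↦ (f i • ξ i : Lp ℝ 2 P)] with x h1 h2
      refine h2.trans ?_
      rw [← Finset.sum_coe_sort]
      exact Finset.sum_congr rfl fun i _ ↦ h1 i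
    have hindF : iIndepFun (fun (i : F) (x : ι → ℝ) ↦ f i * x i) P :=
      (hind.precomp Subtype.val_injective).comp (fun i : F ↦ fun y ↦ f i * y)
        fun _ ↦ by fun_prop
    have hG : HasGaussianLaw (fun x : ι → ℝ ↦ ∑ i : F, f i * x i) P :=
      hindF.hasGaussianLaw_fun_sum fun i ↦ (hlaw i).fun_smul (f i)
    refine map_eq_gaussianReal_of_hasGaussianLaw (hG.congr hae.symm) ?_
    rw [integral_congr_ae hae, integral_finsetSum _ fun (i : F) _ ↦
      ((hL2 i).integrable one_le_two).const_mul _]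
    simp [integral_const_mul, hmean]
  have := isClosed_setOf_map_eq_gaussianReal.mem_of_tendsto hsum (Eventually.of_forall hfin)
  rw [Set.mem_ofPred_eq] at this
  rw [this]
  congr 2
  exact hon.orthogonalFamily.linearIsometry.nnnorm_map f

/-- Existence of a centered Gaussian process with a given positive semidefinite covariance. -/
theorem exists_isGaussianProcess {T : Type} {K : Matrix T T ℝ} (hK : K.PosSemidef) :
    ∃ (Ω : Type) (_ : MeasurableSpace Ω) (P : Measure Ω) (_ : IsProbabilityMeasure P)
      (Y : T → Ω → ℝ), IsGaussianProcess Y P ∧ (∀ t, ∫ ω, Y t ω ∂P = 0) ∧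
      ∀ s t, cov[Y s, Y t; P] = K s t := by
  classical
  obtain ⟨ι, v, hv⟩ := exists_gram hK
  obtain ⟨Ω, mΩ, P, hP, W, hW⟩ := exists_isonormal ι
  have hae : ∀ f, AEMeasurable (W f) P := fun f ↦ (Lp.aestronglyMeasurable _).aemeasurable
  have hmean : ∀ f, ∫ ω, W f ω ∂P = 0 := by
    intro f
    have := integral_map (μ := P) (hae f) (f := fun y : ℝ ↦ y) (by fun_prop)
    rw [← this, hW, integral_id_gaussianReal]
  refine ⟨Ω, mΩ, P, hP, fun t ↦ W (v t), ⟨fun I ↦ ⟨isGaussian_of_map_eq_gaussianReal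
    fun L ↦ ?_⟩⟩, fun t ↦ hmean _, fun s t ↦ ?_⟩
  · let f := ∑ t : I, L (Pi.single t 1) • v t
    refine ⟨0, ‖f‖₊ ^ 2, ?_⟩
    rw [AEMeasurable.map_map_of_aemeasurable L.continuous.measurable.aemeasurable
      (by exact aemeasurable_pi_lambda _ fun t ↦ hae _), ← hW]
    refine Measure.map_congr ?_
    have h1 : ∀ᵐ ω ∂P, ∀ t : I, (L (Pi.single t 1) • W (v t) : Lp ℝ 2 P) ω
        = L (Pi.single t 1) * W (v t) ω := by
      rw [ae_all_iff]
      intro t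
      filter_upwards [Lp.coeFn_smul (L (Pi.single t 1)) (W (v t))] with ω h
      rw [h, Pi.smul_apply, smul_eq_mul]
    filter_upwards [h1, coeFn_sum_Lp Finset.univ fun t : I ↦
      (L (Pi.single t 1) • W (v t) : Lp ℝ 2 P)] with ω h1 h2
    simp only [f, map_sum, map_smul]
    rw [h2, Finset.sum_congr rfl fun t _ ↦ h1 t, Function.comp_apply,
      ← ContinuousLinearMap.coe_coe, LinearMap.pi_apply_eq_sum_univ]
    refine Finset.sum_congr rfl fun t _ ↦ ?_
    rw [smul_eq_mul, mul_comm]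
    congr 2
    ext i
    simp [Pi.single_apply, eq_comm]
  · rw [← hv, ← W.inner_map_map, L2.inner_def, covariance]
    simp [hmean, mul_comm]

/-! ### Spectral representation of Σ -/

theorem sub_I_mul_mul_re (a b : ℝ) (z : ℂ) :
    (((a : ℂ) - Complex.I * (b : ℂ)) * z).re = a * z.re + b * z.im := by
  simp [Complex.mul_re]

namespace MfBmParams

variable {p : ℕ} (θ : MfBmParams p)

theorem add_H_mem (i j : Fin p) : 0 < θ.H i + θ.H j ∧ θ.H i + θ.H j < 2 := by
  have h1 := θ.H_mem i
  have h2 := θ.H_mem j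
  constructor <;> linarith [h1.1, h1.2, h2.1, h2.2]

theorem sin_half_pi_add_H_pos (i j : Fin p) :
    0 < Real.sin (Real.pi / 2 * (θ.H i + θ.H j)) := by
  obtain ⟨h1, h2⟩ := θ.add_H_mem i j
  exact Real.sin_pos_of_pos_of_lt_pi (by positivity) (by nlinarith [Real.pi_pos])

theorem cos_half_pi_add_H_ne_zero {i j : Fin p} (h : θ.H i + θ.H j ≠ 1) :
    Real.cos (Real.pi / 2 * (θ.H i + θ.H j)) ≠ 0 := by
  obtain ⟨h1, h2⟩ := θ.add_H_mem i j
  have hpi := Real.pi_pos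
  rcases lt_or_gt_of_ne h with h3 | h3
  · exact (Real.cos_pos_of_mem_Ioo ⟨by nlinarith, by nlinarith⟩).ne'
  · exact (Real.cos_neg_of_pi_div_two_lt_of_lt (by nlinarith) (by nlinarith)).ne

theorem η_self {i : Fin p} (h : θ.H i + θ.H i ≠ 1) : θ.η i i = 0 := by
  linarith [θ.η_antisymm i i h]

theorem ηt_self {i : Fin p} (h : θ.H i + θ.H i = 1) : θ.ηt i i = 0 := by
  linarith [θ.ηt_antisymm i i h]

theorem star_Q (i j : Fin p) : star (θ.Q i j) = θ.Q j i := by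
  by_cases h : θ.H i + θ.H j = 1
  · have h' : θ.H j + θ.H i = 1 := by rw [add_comm]; exact h
    simp [Q, tau, h, h', θ.ρt_symm i j h, θ.ηt_antisymm i j h]
  · simp [Q, tau, h, θ.ρ_symm i j h, θ.η_antisymm i j h, add_comm (θ.H j),
      -Complex.ofReal_sin, -Complex.ofReal_cos]

theorem isHermitian_Q : θ.Q.IsHermitian := by
  ext i j
  rw [Matrix.conjTranspose_apply, θ.star_Q]

/-- The sine and cosine in `Q` cancel those in the denominators of the spectral integrals. On the
diagonal, antisymmetry forces η_ii = 0, which together with ρ_ii = 1 makes the off-diagonal formula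
collapse to the stated variance form; the same holds for the tilde parameters. -/
theorem covMatrix_eq (s t : ℝ) (i j : Fin p) : θ.covMatrix s t i j
    = θ.σ i * θ.σ j / Real.pi * (θ.Q i j * spectralIntegral (θ.H i + θ.H j) s t).re := by
  obtain ⟨h0, h2⟩ := θ.add_H_mem i j
  have hsin := (θ.sin_half_pi_add_H_pos i j).ne'
  have hre := spectralIntegral_re h0 h2 s t
  have hpi := Real.pi_ne_zero
  by_cases h : θ.H i + θ.H j = 1
  · have hQ : θ.Q i j = ((θ.ρt i j : ℝ) : ℂ) - Complex.I * (Real.pi / 2 * θ.ηt i j : ℝ) := by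
      have : Real.Gamma (1 + 1) = 1 := by norm_num
      simp [Q, tau, h, this]
    have him := spectralIntegral_one_im s t
    have hG : Real.Gamma (1 + 1) = 1 := by norm_num
    rw [h, hG, one_mul, mul_one, Real.sin_pi_div_two] at hre
    have : (θ.Q i j * spectralIntegral (θ.H i + θ.H j) s t).re
        = θ.ρt i j * (Real.pi / 2 * (|s| + |t| - |t - s|)) + Real.pi / 2 * θ.ηt i j
          * (t * Real.log |t| - s * Real.log |s| - (t - s) * Real.log |t - s|) := by
      rw [hQ, h, sub_I_mul_mul_re, hre, him]
      simp only [Real.rpow_one, mul_one]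
    rw [this]
    by_cases hij : i = j
    · subst hij
      rw [θ.ρt_self i h, θ.ηt_self h]
      simp only [covMatrix, Matrix.of_apply, if_true]
      rw [two_mul (θ.H i), h]
      simp only [Real.rpow_one]
      field_simp
      ring
    · simp only [covMatrix, Matrix.of_apply, hij, if_false, h, ne_eq, not_true_eq_false]
      rw [abs_sub_comm s t]
      field_simp
  · have hcos := θ.cos_half_pi_add_H_ne_zero h
    have hQ : θ.Q i j = ((Real.Gamma (θ.H i + θ.H j + 1) *
        (θ.ρ i j * Real.sin (Real.pi / 2 * (θ.H i + θ.H j))) : ℝ) : ℂ)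
        - Complex.I * ((Real.Gamma (θ.H i + θ.H j + 1) *
        (θ.η i j * Real.cos (Real.pi / 2 * (θ.H i + θ.H j))) : ℝ) : ℂ) := by
      simp only [Q, tau, Matrix.of_apply, ne_eq, h, not_false_eq_true, if_true, mul_one]
      push_cast
      ring
    have him := spectralIntegral_im h0 h2 h s t
    have : (θ.Q i j * spectralIntegral (θ.H i + θ.H j) s t).re
        = θ.ρ i j * Real.sin (Real.pi / 2 * (θ.H i + θ.H j)) * (Real.Gamma (θ.H i + θ.H j + 1)
          * (spectralIntegral (θ.H i + θ.H j) s t).re)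
        + θ.η i j * Real.cos (Real.pi / 2 * (θ.H i + θ.H j)) * (Real.Gamma (θ.H i + θ.H j + 1)
          * (spectralIntegral (θ.H i + θ.H j) s t).im) := by
      rw [hQ, sub_I_mul_mul_re]
      ring
    rw [this, hre, him]
    clear this hre him hQ
    by_cases hij : i = j
    · subst hij
      rw [θ.ρ_self i h, θ.η_self h]
      simp only [covMatrix, Matrix.of_apply, if_true]
      rw [two_mul (θ.H i)]
      generalize Real.sin _ = S at *
      field_simp
      ring
    · simp only [covMatrix, Matrix.of_apply, hij, if_false, h, ne_eq, not_false_eq_true, if_true]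
      generalize Real.sin _ = S at *
      generalize Real.cos _ = C at *
      field_simp
      ring

end MfBmParams

theorem star_spectralIntegral (h s t : ℝ) :
    star (spectralIntegral h s t) = spectralIntegral h t s := by
  rw [spectralIntegral, spectralIntegral]
  refine (integral_conj (𝕜 := ℂ)).symm.trans (integral_congr_ae (ae_of_all _ fun x ↦ ?_))
  change star _ = _
  simp only [incrKernel]
  rw [star_smul, star_mul', star_star, mul_comm, star_trivial]

/-! ### Positive semidefinite Q gives a positive semidefinite kernel -/

namespace MfBmParams

variable {p : ℕ} (θ : MfBmParams p)

theorem covMatrix_comm (s t : ℝ) (i j : Fin p) : θ.covMatrix s t i j = θ.covMatrix t s j i := by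
  rw [covMatrix_eq, covMatrix_eq, ← θ.star_Q, ← star_spectralIntegral, add_comm (θ.H j),
    ← star_mul', mul_comm (θ.σ i)]
  simp

/-- The spectral coordinate `x ^ (-1/2 - H_i) (e ^ (i t x) - 1)`. -/
noncomputable def spectralCoord (i : Fin p) (t x : ℝ) : ℂ :=
  (x ^ (-(1 / 2 + θ.H i)) : ℝ) * expIncr t x

/-- Because the exponent is additive in H_i and H_j, the power density is a rank-one factor, so `Q`
alone decides positivity at each frequency. -/
theorem star_spectralCoord_mul (i j : Fin p) (s t : ℝ) {x : ℝ} (hx : 0 < x) :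
    star (θ.spectralCoord i s x) * θ.spectralCoord j t x
      = (x ^ (-(1 + (θ.H i + θ.H j))) : ℝ) • incrKernel s t x := by
  have : x ^ (-(1 + (θ.H i + θ.H j))) = x ^ (-(1 / 2 + θ.H i)) * x ^ (-(1 / 2 + θ.H j)) := by
    rw [← Real.rpow_add hx]; ring_nf
  rw [spectralCoord, spectralCoord, incrKernel, this, Complex.real_smul, star_mul',
    Complex.star_def, Complex.conj_ofReal]
  push_cast
  ring

theorem integrableOn_star_spectralCoord_mul (i j : Fin p) (s t : ℝ) :
    IntegrableOn (fun x ↦ star (θ.spectralCoord i s x) * θ.spectralCoord j t x)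
      (Set.Ioi 0) := by
  obtain ⟨h0, h2⟩ := θ.add_H_mem i j
  exact (integrableOn_congr_fun (fun x hx ↦ θ.star_spectralCoord_mul i j s t hx)
    measurableSet_Ioi).2 (integrableOn_incrKernel h0 h2 s t)

theorem integral_star_spectralCoord_mul (i j : Fin p) (s t : ℝ) :
    ∫ x in Set.Ioi (0 : ℝ), star (θ.spectralCoord i s x) * θ.spectralCoord j t x
      = spectralIntegral (θ.H i + θ.H j) s t :=
  setIntegral_congr_fun measurableSet_Ioi fun _ hx ↦ θ.star_spectralCoord_mul i j s t hx

/-- The kernel on `ℝ × Fin p` associated with the matrix function `Σ`. -/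
noncomputable def covKernel : Matrix (ℝ × Fin p) (ℝ × Fin p) ℝ :=
  Matrix.of fun a b ↦ θ.covMatrix a.1 b.1 a.2 b.2

theorem posSemidef_covKernel (hQ : θ.Q.PosSemidef) : θ.covKernel.PosSemidef := by
  refine ⟨?_, fun u ↦ ?_⟩
  · ext a b
    simp only [Matrix.conjTranspose_apply, star_trivial, covKernel, Matrix.of_apply]
    exact θ.covMatrix_comm _ _ _ _
  let w : ℝ → ℝ × Fin p → ℂ := fun x a ↦ (u a * θ.σ a.2 : ℝ) * θ.spectralCoord a.2 a.1 x
  have hint : ∀ a b : ℝ × Fin p, IntegrableOn (fun x ↦ star (w x a) * θ.Q a.2 b.2 * w x b)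
      (Set.Ioi 0) ∧ ∫ x in Set.Ioi (0 : ℝ), star (w x a) * θ.Q a.2 b.2 * w x b
        = ((u a * θ.σ a.2 * (u b * θ.σ b.2) : ℝ) : ℂ) *
          (θ.Q a.2 b.2 * spectralIntegral (θ.H a.2 + θ.H b.2) a.1 b.1) := by
    intro a b
    have e : ∀ x, star (w x a) * θ.Q a.2 b.2 * w x b
        = ((u a * θ.σ a.2 * (u b * θ.σ b.2) : ℝ) : ℂ) * θ.Q a.2 b.2 *
          (star (θ.spectralCoord a.2 a.1 x) * θ.spectralCoord b.2 b.1 x) := by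
      intro x
      simp only [w, star_mul', Complex.star_def, Complex.conj_ofReal]
      push_cast
      ring
    simp only [e]
    refine ⟨(θ.integrableOn_star_spectralCoord_mul _ _ _ _).const_mul _, ?_⟩
    rw [integral_const_mul, integral_star_spectralCoord_mul, mul_assoc]
  have key : 0 ≤ (∑ a ∈ u.support, ∑ b ∈ u.support,
      ∫ x in Set.Ioi (0 : ℝ), star (w x a) * θ.Q a.2 b.2 * w x b).re := by
    have : ∑ a ∈ u.support, ∑ b ∈ u.support,
        ∫ x in Set.Ioi (0 : ℝ), star (w x a) * θ.Q a.2 b.2 * w x b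
        = ∫ x in Set.Ioi (0 : ℝ), ∑ a ∈ u.support, ∑ b ∈ u.support,
          star (w x a) * θ.Q a.2 b.2 * w x b := by
      rw [integral_finsetSum _ fun a _ ↦ integrable_finsetSum _ fun b _ ↦ (hint a b).1]
      exact Finset.sum_congr rfl fun a _ ↦ (integral_finsetSum _ fun b _ ↦ (hint a b).1).symm
    rw [this, ← RCLike.re_to_complex, ← integral_re
      (integrable_finsetSum _ fun a _ ↦ integrable_finsetSum _ fun b _ ↦ (hint a b).1)]
    refine integral_nonneg fun x ↦ ?_
    -- Several points of the support may share a component index, so rows of `Q` are repeated;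
    -- positive semidefiniteness survives.
    have h := (hQ.submatrix (fun a : u.support ↦ a.1.2)).dotProduct_mulVec_nonneg
      (fun a ↦ w x a)
    have h' := (Complex.le_def.1 h).1
    refine h'.trans_eq ?_
    rw [RCLike.re_to_complex]
    congr 1
    simp only [dotProduct, Matrix.mulVec, Matrix.submatrix_apply, Pi.star_apply,
      Finset.mul_sum, ← mul_assoc]
    rw [← Finset.sum_coe_sort u.support]
    exact Finset.sum_congr rfl fun a _ ↦ Finset.sum_coe_sort u.support
      fun b ↦ star (w x a) * θ.Q a.1.2 b.2 * w x b
  have : (u.sum fun a ua ↦ u.sum fun b ub ↦ star ua * θ.covKernel a b * ub)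
      = 1 / Real.pi * (∑ a ∈ u.support, ∑ b ∈ u.support,
      ∫ x in Set.Ioi (0 : ℝ), star (w x a) * θ.Q a.2 b.2 * w x b).re := by
    simp only [Finsupp.sum, (hint _ _).2, Complex.re_sum, Finset.mul_sum]
    refine Finset.sum_congr rfl fun a _ ↦ Finset.sum_congr rfl fun b _ ↦ ?_
    rw [covKernel, Matrix.of_apply, covMatrix_eq, Complex.re_ofReal_mul, star_trivial]
    ring
  rw [this]
  exact mul_nonneg (by positivity) key

end MfBmParams

/-! ### From covariances to self-similarity and stationary increments -/

/-- The characteristic function of a centered Gaussian vector depends only on its covariances, and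
characteristic functions determine laws. -/
theorem sameFDD_of_covariance {T Ω : Type*} {mΩ : MeasurableSpace Ω} {P : Measure Ω} {p : ℕ}
    {X Y : T → Ω → (Fin p → ℝ)} (hX : IsGaussianProcess X P) (hY : IsGaussianProcess Y P)
    (hX0 : ∀ t i, ∫ ω, X t ω i ∂P = 0) (hY0 : ∀ t i, ∫ ω, Y t ω i ∂P = 0)
    (hXY : ∀ s t i j, cov[fun ω ↦ X s ω i, fun ω ↦ X t ω j; P]
      = cov[fun ω ↦ Y s ω i, fun ω ↦ Y t ω j; P]) : SameFDD P X Y := by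
  classical
  intro I
  have hP : IsProbabilityMeasure P := (hX.hasGaussianLaw ∅).isProbabilityMeasure
  have hXI := hX.hasGaussianLaw I
  have hYI := hY.hasGaussianLaw I
  have : IsProbabilityMeasure (P.map fun ω ↦ I.restrict fun t ↦ X t ω) :=
    hXI.isGaussian_map.toIsProbabilityMeasure
  have : IsProbabilityMeasure (P.map fun ω ↦ I.restrict fun t ↦ Y t ω) :=
    hYI.isGaussian_map.toIsProbabilityMeasure
  refine ⟨hXI.aemeasurable, hYI.aemeasurable, Measure.ext_of_charFunDual (funext fun L ↦ ?_)⟩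
  let c : I × Fin p → ℝ := fun a ↦ L (Pi.single a.1 (Pi.single a.2 1))
  have hL : ∀ z : I → Fin p → ℝ, L z = ∑ a : I × Fin p, c a * z a.1 a.2 := by
    intro z
    have : z = ∑ a : I × Fin p, z a.1 a.2 • Pi.single a.1 (Pi.single a.2 (1 : ℝ)) := by
      ext t i
      simp only [Finset.sum_apply, Pi.smul_apply, Fintype.sum_prod_type, smul_eq_mul,
        Pi.single_apply, apply_ite (fun f : Fin p → ℝ ↦ f i), Pi.zero_apply]
      simp
    conv_lhs => rw [this]
    simp only [map_sum, map_smul, smul_eq_mul, c, mul_comm]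
  have key : ∀ Z : T → Ω → (Fin p → ℝ), IsGaussianProcess Z P →
      (∀ t i, ∫ ω, Z t ω i ∂P = 0) →
      charFunDual (P.map fun ω ↦ I.restrict fun t ↦ Z t ω) L
        = Complex.exp (-((∑ a : I × Fin p, ∑ b : I × Fin p, c b * (c a *
          cov[fun ω ↦ Z a.1 ω a.2, fun ω ↦ Z b.1 ω b.2; P]) : ℝ) : ℂ) / 2) := by
    intro Z hZ hZ0
    have hm : ∀ a : I × Fin p, MemLp (fun ω ↦ c a * Z a.1 ω a.2) 2 P := by
      intro a
      have h1 : HasGaussianLaw (fun ω ↦ Z a.1 ω a.2) P := (hZ.hasGaussianLaw_eval a.1).eval a.2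
      exact h1.memLp_two.const_mul _
    have hmeas : AEMeasurable (fun ω ↦ ∑ a : I × Fin p, c a * Z a.1 ω a.2) P :=
      (memLp_finsetSum _ fun a _ ↦ hm a).1.aemeasurable
    rw [(hZ.hasGaussianLaw I).charFunDual_map_eq_fun]
    simp only [hL, Finset.restrict]
    rw [integral_finsetSum _ fun a _ ↦ (hm a).integrable one_le_two]
    simp only [integral_const_mul, hZ0, mul_zero, Finset.sum_const_zero, Complex.ofReal_zero,
      zero_mul]
    rw [← covariance_self hmeas, covariance_fun_sum_fun_sum hm hm]
    simp only [covariance_const_mul_left, covariance_const_mul_right]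
    congr 1
    ring
  rw [key X hX hX0, key Y hY hY0]
  simp only [hXY]

theorem spectralIntegral_mul {h l : ℝ} (hl : 0 < l) (s t : ℝ) :
    spectralIntegral h (l * s) (l * t) = (l ^ h : ℝ) • spectralIntegral h s t := by
  have h1 := integral_comp_mul_left_Ioi
    (fun x : ℝ ↦ (x ^ (-(1 + h)) : ℝ) • incrKernel s t x) 0 hl
  rw [mul_zero] at h1
  have h2 : ∀ x ∈ Set.Ioi (0 : ℝ), ((l * x) ^ (-(1 + h)) : ℝ) • incrKernel s t (l * x)
      = (l ^ (-(1 + h)) : ℝ) • ((x ^ (-(1 + h)) : ℝ) • incrKernel (l * s) (l * t) x) := by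
    intro x hx
    have : incrKernel s t (l * x) = incrKernel (l * s) (l * t) x := by
      simp only [incrKernel, expIncr]
      rw [show t * (l * x) = l * t * x by ring, show s * (l * x) = l * s * x by ring]
    rw [Real.mul_rpow hl.le (le_of_lt hx), mul_smul, this]
  rw [setIntegral_congr_fun measurableSet_Ioi h2, integral_smul] at h1
  rw [spectralIntegral, spectralIntegral]
  have h3 : (l ^ h : ℝ) * l⁻¹ = l ^ (-(1 + h)) * (l ^ h * l ^ h) := by
    rw [← Real.rpow_neg_one, ← Real.rpow_add hl, ← Real.rpow_add hl, ← Real.rpow_add hl]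
    ring_nf
  have h4 : l ^ (-(1 + h)) ≠ 0 := (Real.rpow_pos_of_pos hl _).ne'
  have h5 : l ^ h ≠ 0 := (Real.rpow_pos_of_pos hl _).ne'
  refine smul_right_injective ℂ h4 ?_
  simp only
  rw [h1, ← mul_smul]
  congr 1
  rw [Real.rpow_neg hl.le, Real.rpow_add hl, Real.rpow_one]
  field_simp

/-- Shifting by r multiplies e^(iux) - 1 by the unimodular factor e^(irx), which cancels against its
conjugate in the kernel. -/
theorem spectralIntegral_increment {h : ℝ} (h0 : 0 < h) (h2 : h < 2) (r s t : ℝ) :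
    spectralIntegral h (s + r) (t + r) - spectralIntegral h r (t + r)
      - spectralIntegral h (s + r) r + spectralIntegral h r r = spectralIntegral h s t := by
  have hi := integrableOn_incrKernel h0 h2
  have e1 : ∀ u x : ℝ, expIncr (u + r) x - expIncr r x
      = expIncr u x * Complex.exp (Complex.I * (r * x : ℝ)) := by
    intro u x
    have : Complex.exp (Complex.I * ((u + r) * x : ℝ))
        = Complex.exp (Complex.I * (u * x : ℝ)) * Complex.exp (Complex.I * (r * x : ℝ)) := by
      rw [← Complex.exp_add]; push_cast; congr 1; ring
    rw [expIncr, expIncr, expIncr, this]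
    ring
  have e2 : ∀ x : ℝ, Complex.exp (Complex.I * (r * x : ℝ))
      * star (Complex.exp (Complex.I * (r * x : ℝ))) = 1 := by
    intro x
    rw [Complex.star_def, Complex.mul_conj, Complex.normSq_eq_norm_sq,
      Complex.norm_exp_I_mul_ofReal]
    norm_num
  have hpt : ∀ x : ℝ, incrKernel s t x = incrKernel (s + r) (t + r) x - incrKernel r (t + r) x
      - incrKernel (s + r) r x + incrKernel r r x := by
    intro x
    calc incrKernel s t x = (expIncr t x * Complex.exp (Complex.I * (r * x : ℝ)))
          * star (expIncr s x * Complex.exp (Complex.I * (r * x : ℝ))) := by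
          rw [incrKernel, star_mul']
          linear_combination (-(expIncr t x * star (expIncr s x))) * e2 x
      _ = _ := by
          rw [← e1, ← e1, star_sub]
          simp only [incrKernel]
          ring
  conv_rhs => rw [spectralIntegral]
  simp only [hpt, smul_add, smul_sub]
  rw [integral_add (by exact ((hi _ _).sub (hi _ _)).sub (hi _ _)) (hi _ _),
    integral_sub (by exact (hi _ _).sub (hi _ _)) (hi _ _), integral_sub (hi _ _) (hi _ _)]
  rfl

namespace MfBmParams

variable {p : ℕ} (θ : MfBmParams p)

theorem covMatrix_mul {l : ℝ} (hl : 0 < l) (s t : ℝ) (i j : Fin p) :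
    θ.covMatrix (l * s) (l * t) i j = l ^ θ.H i * (l ^ θ.H j * θ.covMatrix s t i j) := by
  rw [covMatrix_eq, covMatrix_eq, spectralIntegral_mul hl, mul_smul_comm, Complex.smul_re,
    Real.rpow_add hl, smul_eq_mul]
  ring

theorem covMatrix_increment (r s t : ℝ) (i j : Fin p) :
    θ.covMatrix (s + r) (t + r) i j - θ.covMatrix r (t + r) i j - θ.covMatrix (s + r) r i j
      + θ.covMatrix r r i j = θ.covMatrix s t i j := by
  obtain ⟨h0, h2⟩ := θ.add_H_mem i j
  simp only [covMatrix_eq]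
  rw [← spectralIntegral_increment h0 h2 r s t]
  simp only [mul_add, mul_sub, Complex.add_re, Complex.sub_re]

theorem isMfBmCovariance_of_posSemidef (hQ : θ.Q.PosSemidef) :
    IsMfBmCovariance θ.H θ.covMatrix := by
  classical
  obtain ⟨Ω, mΩ, P, hP, Y, hY, hY0, hYcov⟩ := exists_isGaussianProcess (θ.posSemidef_covKernel hQ)
  let X : ℝ → Ω → (Fin p → ℝ) := fun t ω i ↦ Y (t, i) ω
  have hX : IsGaussianProcess X P := by
    refine hY.of_isGaussianProcess fun t ↦ ⟨Finset.univ.image fun i ↦ (t, i),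
      ContinuousLinearMap.pi fun i ↦ ContinuousLinearMap.proj ⟨(t, i), by simp⟩, fun ω ↦ ?_⟩
    ext i
    rfl
  have hL2 : ∀ t i, MemLp (fun ω ↦ X t ω i) 2 P :=
    fun t i ↦ (hY.hasGaussianLaw_eval (t, i)).memLp_two
  have hX0 : ∀ t i, ∫ ω, X t ω i ∂P = 0 := fun t i ↦ hY0 (t, i)
  have hcov : ∀ s t i j, cov[fun ω ↦ X s ω i, fun ω ↦ X t ω j; P] = θ.covMatrix s t i j :=
    fun s t i j ↦ hYcov (s, i) (t, j)
  have hincr : ∀ r, IsGaussianProcess (fun t ω ↦ X (t + r) ω - X r ω) P := by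
    intro r
    have := hX.shift r
    simpa only [add_comm r] using this
  have hincr0 : ∀ r t i, ∫ ω, (X (t + r) ω - X r ω) i ∂P = 0 := by
    intro r t i
    simp only [Pi.sub_apply]
    rw [integral_sub ((hL2 _ _).integrable one_le_two) ((hL2 _ _).integrable one_le_two),
      hX0, hX0, sub_zero]
  have hincrcov : ∀ r s t i j, cov[fun ω ↦ (X (s + r) ω - X r ω) i,
      fun ω ↦ (X (t + r) ω - X r ω) j; P] = θ.covMatrix s t i j := by
    intro r s t i j
    simp only [Pi.sub_apply]
    rw [covariance_fun_sub_left (hL2 _ _) (hL2 _ _) (by exact (hL2 _ _).sub (hL2 _ _)),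
      covariance_fun_sub_right (hL2 _ _) (hL2 _ _) (hL2 _ _),
      covariance_fun_sub_right (hL2 _ _) (hL2 _ _) (hL2 _ _),
      hcov, hcov, hcov, hcov, ← θ.covMatrix_increment r s t i j]
    ring
  refine ⟨Ω, mΩ, P, X, hP, ⟨θ.H_mem, hX, fun l hl ↦ ?_, fun r ↦ ?_⟩, hL2, hcov⟩
  · refine sameFDD_of_covariance (hX.comp_right (l * ·)) ?_ (fun t i ↦ hX0 _ _) (fun t i ↦ ?_)
      fun s t i j ↦ ?_
    · exact hX.comp_left fun _ ↦ ContinuousLinearMap.pi fun i ↦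
        (l ^ θ.H i) • ContinuousLinearMap.proj (R := ℝ) (φ := fun _ : Fin p ↦ ℝ) i
    · simp only [integral_const_mul, hX0, mul_zero]
    · rw [covariance_const_mul_left, covariance_const_mul_right, hcov s t i j]
      exact (hcov _ _ _ _).trans (θ.covMatrix_mul hl _ _ _ _)
  · have h0 : (fun (t : ℝ) ω ↦ X t ω - X 0 ω) = fun t ω ↦ X (t + 0) ω - X 0 ω := by
      simp only [add_zero]
    rw [h0]
    refine sameFDD_of_covariance (hincr r) (hincr 0) (hincr0 r) (hincr0 0) fun s t i j ↦ ?_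
    rw [hincrcov, hincrcov]

end MfBmParams

/-! ### Trigonometric weights concentrating at frequency 1 -/

/-- Write cos^(2n) as (1 - sin²)^n; then n sin²(y/√n) = y² sinc²(y/√n) tends to y². -/
theorem tendsto_cos_div_sqrt_pow (y : ℝ) :
    Tendsto (fun n : ℕ ↦ Real.cos (y / √n) ^ (2 * n)) atTop (𝓝 (Real.exp (-y ^ 2))) := by
  have h1 : ∀ n : ℕ, Real.cos (y / √n) ^ (2 * n) = (1 + -(Real.sin (y / √n) ^ 2)) ^ n := by
    intro n
    rw [pow_mul, Real.cos_sq', sub_eq_add_neg]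
  simp only [h1]
  refine Real.tendsto_one_add_pow_exp_of_tendsto ?_
  have h2 : Tendsto (fun n : ℕ ↦ y / √n) atTop (𝓝 0) :=
    (Real.tendsto_sqrt_atTop.comp tendsto_natCast_atTop_atTop).const_div_atTop y
  have h3 : Tendsto (fun n : ℕ ↦ -(y ^ 2) * Real.sinc (y / √n) ^ 2) atTop (𝓝 (-(y ^ 2) * 1 ^ 2)) := by
    refine Tendsto.const_mul _ (Tendsto.pow ?_ 2)
    have := (Real.continuous_sinc.tendsto 0).comp h2
    rwa [Real.sinc_zero] at this
  rw [one_pow, mul_one] at h3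
  refine h3.congr' ?_
  filter_upwards [eventually_gt_atTop 0] with n hn
  have hn' : (0 : ℝ) < n := by exact_mod_cast hn
  rcases eq_or_ne y 0 with rfl | hy
  · simp
  · have : y / √n ≠ 0 := by positivity
    rw [Real.sinc_of_ne_zero this, div_pow, div_pow, Real.sq_sqrt hn'.le]
    field_simp

/-- `cos (b (x - 1)) ^ n` is a trigonometric polynomial. -/
theorem cos_pow_eq_sum_exp (b : ℝ) (n : ℕ) :
    ∃ (d : Fin (n + 1) → ℂ) (τ : Fin (n + 1) → ℝ), ∀ x : ℝ,
      ((Real.cos (b * (x - 1)) ^ n : ℝ) : ℂ)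
        = ∑ k, d k * Complex.exp (Complex.I * (τ k * x : ℝ)) := by
  -- Binomial expansion of ((e^(iθ) + e^(-iθ))/2)^n at θ = b(x - 1); the shift by 1 goes into the
  -- coefficients as a phase.
  refine ⟨fun k ↦ (1 / 2 : ℂ) ^ n * (n.choose k : ℂ) *
    Complex.exp (-(Complex.I * (b * (2 * k - n) : ℝ))), fun k ↦ b * (2 * k - n), fun x ↦ ?_⟩
  have h1 : ((Real.cos (b * (x - 1)) : ℝ) : ℂ) = 1 / 2 *
      (Complex.exp (Complex.I * (b * (x - 1) : ℝ))
        + Complex.exp (-(Complex.I * (b * (x - 1) : ℝ)))) := by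
    rw [Complex.ofReal_cos, Complex.cos]
    rw [mul_comm _ Complex.I, neg_mul, mul_comm _ Complex.I]
    ring
  rw [Complex.ofReal_pow, h1, mul_pow, add_pow, Finset.sum_range, Finset.mul_sum]
  refine Finset.sum_congr rfl fun k _ ↦ ?_
  rw [← Complex.exp_nat_mul, ← Complex.exp_nat_mul, ← Complex.exp_add, mul_assoc, mul_assoc,
    mul_assoc, ← Complex.exp_add, mul_comm (Complex.exp _)]
  congr 3
  rw [Nat.cast_sub (Nat.lt_succ_iff.1 k.2)]
  push_cast
  ring

/-- Re(conj(c_a) c_b) splits into products of real parts and of imaginary parts, so the sum is that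
of two variances. -/
theorem re_nonneg_of_covariance {Ω A : Type*} [Fintype A] {mΩ : MeasurableSpace Ω} {P : Measure Ω}
    [IsProbabilityMeasure P] {Y : A → Ω → ℝ} (hY : ∀ a, MemLp (Y a) 2 P) (c : A → ℂ) :
    0 ≤ (∑ a, ∑ b, star (c a) * c b * (cov[Y a, Y b; P] : ℝ)).re := by
  have hreal : ∀ u : A → ℝ, 0 ≤ ∑ a, ∑ b, u a * u b * cov[Y a, Y b; P] := by
    intro u
    have hm : ∀ a, MemLp (fun ω ↦ u a * Y a ω) 2 P := fun a ↦ (hY a).const_mul _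
    have h := variance_nonneg (fun ω ↦ ∑ a, u a * Y a ω) P
    rw [← covariance_self (memLp_finsetSum _ fun a _ ↦ hm a).1.aemeasurable,
      covariance_fun_sum_fun_sum hm hm] at h
    simp only [covariance_const_mul_left, covariance_const_mul_right] at h
    refine h.trans_eq (Finset.sum_congr rfl fun a _ ↦ Finset.sum_congr rfl fun b _ ↦ ?_)
    ring
  refine (add_nonneg (hreal fun a ↦ (c a).re) (hreal fun a ↦ (c a).im)).trans_eq ?_
  simp only [Complex.re_sum, ← Finset.sum_add_distrib]
  refine Finset.sum_congr rfl fun a _ ↦ Finset.sum_congr rfl fun b _ ↦ ?_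
  simp
  ring

/-- If the integrals of `F` against the functions `cos (b (x - 1)) ^ (2 n)` are nonnegative, then so
is `F 1`. -/
theorem re_nonneg_of_integral_cos_pow {F : ℝ → ℂ} (hF : Integrable F) (hc : ContinuousAt F 1)
    (h : ∀ (b : ℝ) (n : ℕ), 0 ≤ (∫ x, ((Real.cos (b * (x - 1)) ^ (2 * n) : ℝ) : ℂ) * F x).re) :
    0 ≤ (F 1).re := by
  -- Dominated convergence, with cosine powers bounded by 1, passes from cosine weights of frequency
  -- a/√n to Gaussian weights.
  have hgauss : ∀ a : ℝ, 0 ≤ (∫ x, ((Real.exp (-(a * (x - 1)) ^ 2) : ℝ) : ℂ) * F x).re := by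
    intro a
    have hlim : Tendsto (fun n : ℕ ↦
        ∫ x, ((Real.cos (a / √n * (x - 1)) ^ (2 * n) : ℝ) : ℂ) * F x) atTop
        (𝓝 (∫ x, ((Real.exp (-(a * (x - 1)) ^ 2) : ℝ) : ℂ) * F x)) := by
      refine tendsto_integral_of_dominated_convergence (fun x ↦ ‖F x‖) (fun n ↦ ?_) hF.norm
        (fun n ↦ ae_of_all _ fun x ↦ ?_) (ae_of_all _ fun x ↦ ?_)
      · refine AEStronglyMeasurable.mul ?_ hF.1
        exact (by fun_prop : Continuous fun x : ℝ ↦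
          ((Real.cos (a / √n * (x - 1)) ^ (2 * n) : ℝ) : ℂ)).aestronglyMeasurable
      · rw [norm_mul, Complex.norm_real, norm_pow]
        exact mul_le_of_le_one_left (norm_nonneg _)
          (pow_le_one₀ (norm_nonneg _) (Real.abs_cos_le_one _))
      · refine Tendsto.mul_const _ ?_
        refine (Complex.continuous_ofReal.tendsto _).comp ?_
        refine (tendsto_cos_div_sqrt_pow (a * (x - 1))).congr fun n ↦ ?_
        rw [mul_div_right_comm]
    exact ge_of_tendsto ((Complex.continuous_re.tendsto _).comp hlim)
      (Eventually.of_forall fun n ↦ h _ n)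
  have hlim := Real.tendsto_integral_gaussian_smul' hF hc
  refine ge_of_tendsto ((Complex.continuous_re.tendsto _).comp hlim) ?_
  filter_upwards [eventually_gt_atTop 0] with c hc0
  -- The Gaussian approximate identity at 1 has rate a = π√c; its normalizing constant is
  -- nonnegative and does not affect the sign.
  have hpt : ∀ w : ℝ, ((Real.pi * c : ℂ) ^ (Module.finrank ℝ ℝ / 2 : ℂ) *
      Complex.exp (-Real.pi ^ 2 * c * ‖(1 : ℝ) - w‖ ^ 2)) • F w
      = (((Real.pi * c) ^ (1 / 2 : ℝ) : ℝ) : ℂ) *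
        (((Real.exp (-(Real.pi * √c * (w - 1)) ^ 2) : ℝ) : ℂ) * F w) := by
    intro w
    have e1 : ((Real.pi * c : ℂ) ^ (Module.finrank ℝ ℝ / 2 : ℂ))
        = (((Real.pi * c) ^ (1 / 2 : ℝ) : ℝ) : ℂ) := by
      rw [Complex.ofReal_cpow (by positivity)]
      simp
    have e2 : Complex.exp (-Real.pi ^ 2 * c * ‖(1 : ℝ) - w‖ ^ 2)
        = ((Real.exp (-(Real.pi * √c * (w - 1)) ^ 2) : ℝ) : ℂ) := by
      rw [← Complex.ofReal_pow ‖(1 : ℝ) - w‖, Real.norm_eq_abs, sq_abs, mul_pow, mul_pow,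
        Real.sq_sqrt hc0.le]
      push_cast
      congr 1
      ring
    rw [e1, e2, smul_eq_mul, mul_assoc]
  simp only [Function.comp_apply, hpt]
  rw [integral_const_mul, Complex.re_ofReal_mul]
  exact mul_nonneg (by positivity) (hgauss _)

theorem integrable_star {X : Type*} {mX : MeasurableSpace X} {μ : Measure X} {f : X → ℂ}
    (hf : Integrable f μ) : Integrable (fun x ↦ star (f x)) μ :=
  hf.mono (continuous_star.comp_aestronglyMeasurable hf.1) (ae_of_all _ fun x ↦ by simp)

/-! ### A covariance Σ forces Q to be positive semidefinite -/

namespace MfBmParams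

variable {p : ℕ} (θ : MfBmParams p)

/-- The spectral density matrix, up to the factors `σ_i σ_j`. -/
noncomputable def spectralDensity (i j : Fin p) (x : ℝ) : ℂ :=
  (|x| ^ (-(1 + (θ.H i + θ.H j))) : ℝ) * if 0 < x then θ.Q i j else star (θ.Q i j)

theorem integrable_spectralDensity_mul (i j : Fin p) (s t : ℝ) :
    Integrable (fun x ↦ θ.spectralDensity i j x * incrKernel s t x) ∧
    ∫ x, θ.spectralDensity i j x * incrKernel s t x
      = θ.Q i j * spectralIntegral (θ.H i + θ.H j) s t
        + star (θ.Q i j * spectralIntegral (θ.H i + θ.H j) s t) := by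
  obtain ⟨h0, h2⟩ := θ.add_H_mem i j
  have hi := integrableOn_incrKernel h0 h2 s t
  have hpos : ∀ x ∈ Set.Ioi (0 : ℝ), θ.spectralDensity i j x * incrKernel s t x
      = θ.Q i j * ((x ^ (-(1 + (θ.H i + θ.H j))) : ℝ) • incrKernel s t x) := by
    intro x hx
    have hx' : (0 : ℝ) < x := hx
    rw [spectralDensity, if_pos hx', abs_of_pos hx', Complex.real_smul]
    ring
  have hneg : ∀ x ∈ Set.Ioi (0 : ℝ), θ.spectralDensity i j (-x) * incrKernel s t (-x)
      = star (θ.Q i j * ((x ^ (-(1 + (θ.H i + θ.H j))) : ℝ) • incrKernel s t x)) := by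
    intro x hx
    have hx' : (0 : ℝ) < x := hx
    rw [spectralDensity, if_neg (by linarith), abs_neg, abs_of_pos hx', Complex.real_smul,
      ← star_incrKernel, star_mul', star_mul', Complex.star_def, Complex.conj_ofReal]
    ring
  have i1 : IntegrableOn (fun x ↦ θ.spectralDensity i j x * incrKernel s t x) (Set.Ioi 0) :=
    (integrableOn_congr_fun hpos measurableSet_Ioi).2 (hi.const_mul _)
  have i2 : IntegrableOn (fun x ↦ θ.spectralDensity i j x * incrKernel s t x) (Set.Iic 0) := by
    have : IntegrableOn (fun x ↦ θ.spectralDensity i j (-x) * incrKernel s t (-x))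
        (Set.Ioi 0) := by
      refine (integrableOn_congr_fun hneg measurableSet_Ioi).2 ?_
      exact integrable_star (hi.const_mul (θ.Q i j))
    rw [integrableOn_Iic_iff_integrableOn_Iio, ← (Measure.measurePreserving_neg
      (volume : Measure ℝ)).integrableOn_comp_preimage (MeasurableEquiv.neg ℝ).measurableEmbedding]
    simpa [Function.comp_def] using this
  have hint : Integrable (fun x ↦ θ.spectralDensity i j x * incrKernel s t x) := by
    rw [← integrableOn_univ, ← Set.Iic_union_Ioi (a := (0 : ℝ))]
    exact i2.union i1
  refine ⟨hint, ?_⟩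
  have h3 := integral_comp_neg_Ioi 0 fun x ↦ θ.spectralDensity i j x * incrKernel s t x
  rw [neg_zero] at h3
  rw [← intervalIntegral.integral_Iic_add_Ioi i2 i1, ← h3,
    setIntegral_congr_fun measurableSet_Ioi hpos, setIntegral_congr_fun measurableSet_Ioi hneg,
    add_comm]
  congr 1
  · rw [integral_const_mul, spectralIntegral]
  · refine (integral_conj (𝕜 := ℂ)).trans ?_
    rw [integral_const_mul, spectralIntegral]
    rfl

/-- The density of the spectral measure of the process `∑ i, conj (z i) X_i / σ_i`. -/
noncomputable def combinedDensity (z : Fin p → ℂ) (x : ℝ) : ℂ :=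
  ∑ i, ∑ j, star (z i) * z j * θ.spectralDensity i j x

theorem re_integral_combinedDensity_nonneg
    (hS : IsCovarianceMatrixFunction θ.covMatrix) (z : Fin p → ℂ) {α : Type*} [Fintype α]
    (d : α → ℂ) (τ : α → ℝ) :
    0 ≤ (∫ x, θ.combinedDensity z x * ((∑ a, d a * expIncr (τ a) x)
      * star (∑ a, d a * expIncr (τ a) x))).re := by
  obtain ⟨Ω, mΩ, P, X, hP, hL2, hcov⟩ := hS
  -- Dividing z_i by σ_i removes the scale factors that Σ carries and the density does not; the
  -- integral is then 2π times this quadratic form.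
  have hpos := re_nonneg_of_covariance (A := α × Fin p) (fun a ↦ hL2 (τ a.1) a.2)
    fun a ↦ z a.2 / θ.σ a.2 * d a.1
  have hpt : ∀ x, θ.combinedDensity z x * ((∑ a, d a * expIncr (τ a) x)
      * star (∑ a, d a * expIncr (τ a) x)) = ∑ a : α × Fin p, ∑ b : α × Fin p,
      star (z a.2 * d a.1) * (z b.2 * d b.1) *
        (θ.spectralDensity a.2 b.2 x * incrKernel (τ a.1) (τ b.1) x) := by
    intro x
    have hD : (∑ a, d a * expIncr (τ a) x) * star (∑ a, d a * expIncr (τ a) x)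
        = ∑ a, ∑ b, star (d a) * d b * incrKernel (τ a) (τ b) x := by
      rw [mul_comm, star_sum, Finset.sum_mul_sum]
      refine Finset.sum_congr rfl fun a _ ↦ Finset.sum_congr rfl fun b _ ↦ ?_
      rw [incrKernel, star_mul']
      ring
    rw [hD]
    simp only [combinedDensity, Fintype.sum_prod_type_right, Finset.sum_mul]
    refine Finset.sum_congr rfl fun i _ ↦ ?_
    refine Eq.trans ?_ Finset.sum_comm
    refine Finset.sum_congr rfl fun j _ ↦ ?_
    rw [Finset.mul_sum]
    refine Finset.sum_congr rfl fun a _ ↦ ?_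
    rw [Finset.mul_sum]
    refine Finset.sum_congr rfl fun b _ ↦ ?_
    rw [star_mul']
    ring
  have hint := fun a b : α × Fin p ↦
    θ.integrable_spectralDensity_mul a.2 b.2 (τ a.1) (τ b.1)
  simp only [hpt]
  rw [integral_finsetSum _ fun a _ ↦ integrable_finsetSum _ fun b _ ↦ (hint a b).1.const_mul _]
  simp only [integral_finsetSum Finset.univ fun b _ ↦ (hint _ b).1.const_mul _,
    integral_const_mul, (hint _ _).2]
  have : ∀ a b : α × Fin p, (star (z a.2 * d a.1) * (z b.2 * d b.1) *
        (θ.Q a.2 b.2 * spectralIntegral (θ.H a.2 + θ.H b.2) (τ a.1) (τ b.1)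
        + star (θ.Q a.2 b.2 * spectralIntegral (θ.H a.2 + θ.H b.2) (τ a.1) (τ b.1)))).re
      = 2 * Real.pi * (star (z a.2 / θ.σ a.2 * d a.1) * (z b.2 / θ.σ b.2 * d b.1) *
        (θ.covMatrix (τ a.1) (τ b.1) a.2 b.2 : ℝ)).re := by
    intro a b
    have h1 := (θ.σ_pos a.2).ne'
    have h2 := (θ.σ_pos b.2).ne'
    have h3 : star (z a.2 / θ.σ a.2 * d a.1) * (z b.2 / θ.σ b.2 * d b.1)
        = star (z a.2 * d a.1) * (z b.2 * d b.1) * ((1 / (θ.σ a.2 * θ.σ b.2) : ℝ) : ℂ) := by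
      simp only [Complex.star_def, map_mul, map_div₀, Complex.conj_ofReal]
      push_cast
      ring
    rw [h3, covMatrix_eq, Complex.star_def, Complex.add_conj, mul_assoc _ (Complex.ofReal _),
      ← Complex.ofReal_mul, Complex.re_mul_ofReal, Complex.re_mul_ofReal]
    field_simp
  simp only [Complex.re_sum, this, ← Finset.mul_sum]
  simp only [Complex.re_sum] at hpos
  refine mul_nonneg (by positivity) (hpos.trans_eq ?_)
  simp only [hcov]

theorem continuousAt_combinedDensity_one (z : Fin p → ℂ) :
    ContinuousAt (θ.combinedDensity z) 1 := by
  unfold combinedDensity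
  refine tendsto_finsetSum _ fun i _ ↦ tendsto_finsetSum _ fun j _ ↦ ?_
  refine Tendsto.const_mul _ ?_
  have h : ContinuousAt (fun x : ℝ ↦ ((|x| ^ (-(1 + (θ.H i + θ.H j))) : ℝ) : ℂ) * θ.Q i j) 1 := by
    refine ContinuousAt.mul ?_ continuousAt_const
    refine Complex.continuous_ofReal.continuousAt.comp ?_
    exact continuous_abs.continuousAt.rpow_const (Or.inl (by simp))
  refine h.congr_of_eventuallyEq ?_
  filter_upwards [lt_mem_nhds (zero_lt_one (α := ℝ))] with x hx
  rw [spectralDensity, if_pos hx]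

theorem combinedDensity_one (z : Fin p → ℂ) :
    θ.combinedDensity z 1 = star z ⬝ᵥ θ.Q.mulVec z := by
  simp only [combinedDensity, spectralDensity, dotProduct, Matrix.mulVec, Finset.mul_sum,
    abs_one, Real.one_rpow, zero_lt_one, if_true, Complex.ofReal_one, one_mul, Pi.star_apply]
  refine Finset.sum_congr rfl fun i _ ↦ Finset.sum_congr rfl fun j _ ↦ ?_
  ring

/-- The factor |e^(ix) - 1|² compensates the singularity of the density at the origin. -/
theorem integrable_combinedDensity_mul (z : Fin p → ℂ) :
    Integrable fun x ↦ incrKernel 1 1 x * θ.combinedDensity z x := by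
  simp only [combinedDensity, Finset.mul_sum]
  refine integrable_finsetSum _ fun i _ ↦ integrable_finsetSum _ fun j _ ↦ ?_
  refine ((θ.integrable_spectralDensity_mul i j 1 1).1.const_mul (star (z i) * z j)).congr
    (ae_of_all _ fun x ↦ ?_)
  ring

theorem posSemidef_of_isCovarianceMatrixFunction
    (hS : IsCovarianceMatrixFunction θ.covMatrix) : θ.Q.PosSemidef := by
  refine .of_dotProduct_mulVec_nonneg θ.isHermitian_Q fun z ↦ ?_
  have hF := re_nonneg_of_integral_cos_pow (θ.integrable_combinedDensity_mul z)
    ((continuous_incrKernel 1 1).continuousAt.mul (θ.continuousAt_combinedDensity_one z))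
    fun b n ↦ by
      obtain ⟨d, τ, hd⟩ := cos_pow_eq_sum_exp b n
      -- The Boolean index encodes (e^(ix) - 1) e^(iτx) = (e^(i(τ+1)x) - 1) - (e^(iτx) - 1), so the
      -- test function is an admissible combination of increments.
      refine (θ.re_integral_combinedDensity_nonneg hS z (α := Fin (n + 1) × Bool)
        (fun a ↦ bif a.2 then d a.1 else -d a.1)
        (fun a ↦ bif a.2 then τ a.1 + 1 else τ a.1)).trans_eq ?_
      congr 1
      refine integral_congr_ae (ae_of_all _ fun x ↦ ?_)
      have hD : (∑ a : Fin (n + 1) × Bool, (bif a.2 then d a.1 else -d a.1)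
          * expIncr (bif a.2 then τ a.1 + 1 else τ a.1) x)
          = expIncr 1 x * ((Real.cos (b * (x - 1)) ^ n : ℝ) : ℂ) := by
        rw [hd, Finset.mul_sum, Fintype.sum_prod_type]
        refine Finset.sum_congr rfl fun k _ ↦ ?_
        have : Complex.exp (Complex.I * ((τ k + 1) * x : ℝ))
            = Complex.exp (Complex.I * (τ k * x : ℝ)) * Complex.exp (Complex.I * (1 * x : ℝ)) := by
          rw [← Complex.exp_add]; push_cast; congr 1; ring
        simp only [Fintype.sum_bool, cond_true, cond_false, expIncr]
        rw [this]
        ring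
      simp only [hD, incrKernel, star_mul', Complex.star_def, Complex.conj_ofReal]
      push_cast
      ring
  have h1 : incrKernel 1 1 1 = ((‖expIncr 1 1‖ ^ 2 : ℝ) : ℂ) := by
    rw [incrKernel, Complex.star_def, Complex.mul_conj, Complex.normSq_eq_norm_sq]
  -- The weight at the point of concentration must not vanish: e^i ≠ 1 because sin 1 > 0.
  have h2 : expIncr 1 1 ≠ 0 := by
    intro h
    have h3 := congrArg Complex.im h
    rw [expIncr, mul_comm Complex.I, Complex.sub_im, Complex.exp_ofReal_mul_I_im] at h3
    have := Real.sin_pos_of_pos_of_lt_pi one_pos (by linarith [Real.pi_gt_three])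
    simp at h3
    linarith
  rw [h1, combinedDensity_one, Complex.re_ofReal_mul] at hF
  rw [Complex.le_def]
  refine ⟨nonneg_of_mul_nonneg_right hF (by positivity), ?_⟩
  have := θ.isHermitian_Q.im_star_dotProduct_mulVec_self z
  exact this.symm

theorem isMfBmCovariance_iff : IsMfBmCovariance θ.H θ.covMatrix ↔ θ.Q.PosSemidef :=
  ⟨fun ⟨Ω, mΩ, P, X, hP, _, hX⟩ ↦
    θ.posSemidef_of_isCovarianceMatrixFunction ⟨Ω, mΩ, P, X, hP, hX⟩,
    θ.isMfBmCovariance_of_posSemidef⟩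

theorem isCovarianceMatrixFunction_iff :
    IsCovarianceMatrixFunction θ.covMatrix ↔ θ.Q.PosSemidef :=
  ⟨θ.posSemidef_of_isCovarianceMatrixFunction, fun hQ ↦
    let ⟨Ω, mΩ, P, X, hP, _, hX⟩ := θ.isMfBmCovariance_of_posSemidef hQ
    ⟨Ω, mΩ, P, X, hP, hX⟩⟩

end MfBmParams

/-! ### Two components and the coherence -/

theorem Matrix.IsHermitian.posSemidef_fin_two_iff {M : Matrix (Fin 2) (Fin 2) ℂ}
    (hM : M.IsHermitian) {A B : ℝ} (hA : 0 < A) (h0 : M 0 0 = A) (h1 : M 1 1 = B) :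
    M.PosSemidef ↔ Complex.normSq (M 0 1) ≤ A * B := by
  have h10 : M 1 0 = star (M 0 1) := (hM.apply 1 0).symm
  constructor
  · intro h
    have hd := (Complex.le_def.1 h.det_nonneg).1
    rw [Matrix.det_fin_two, h10, h0, h1, Complex.star_def, Complex.mul_conj, ← Complex.ofReal_mul,
      ← Complex.ofReal_sub, Complex.ofReal_re, Complex.zero_re] at hd
    linarith
  · intro h
    refine .of_dotProduct_mulVec_nonneg hM fun z ↦ Complex.le_def.2 ⟨?_,
      (hM.im_star_dotProduct_mulVec_self z).symm⟩
    rw [Complex.normSq_apply] at h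
    -- Completing the square, with m = M 0 1: A z*Mz = |A z₀ + m z₁|² + (AB - |m|²)|z₁|².
    have hsq : A * (star z ⬝ᵥ M.mulVec z).re
        = (A * (z 0).re + (M 0 1).re * (z 1).re - (M 0 1).im * (z 1).im) ^ 2
          + (A * (z 0).im + (M 0 1).re * (z 1).im + (M 0 1).im * (z 1).re) ^ 2
          + (A * B - ((M 0 1).re * (M 0 1).re + (M 0 1).im * (M 0 1).im))
            * ((z 1).re ^ 2 + (z 1).im ^ 2) := by
      simp only [dotProduct, Matrix.mulVec, Fin.sum_univ_two, h0, h1, h10, Pi.star_apply,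
        Complex.star_def, Complex.mul_re, Complex.mul_im, Complex.add_re, Complex.add_im,
        Complex.conj_re, Complex.conj_im, Complex.ofReal_re, Complex.ofReal_im]
      ring
    have : 0 ≤ A * (star z ⬝ᵥ M.mulVec z).re := by
      rw [hsq]
      have := sub_nonneg.2 h
      positivity
    exact nonneg_of_mul_nonneg_right this hA

namespace MfBmParams

variable {p : ℕ} (θ : MfBmParams p)

theorem Q_self (i : Fin p) :
    θ.Q i i = (Real.Gamma (2 * θ.H i + 1) * Real.sin (Real.pi * θ.H i) : ℝ) := by
  have e : Real.pi / 2 * (θ.H i + θ.H i) = Real.pi * θ.H i := by ring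
  by_cases h : θ.H i + θ.H i = 1
  · have e2 : Real.pi * θ.H i = Real.pi / 2 := by rw [← e, h, mul_one]
    rw [e2, two_mul, Real.sin_pi_div_two]
    simp [Q, tau, h, θ.ρt_self i h, θ.ηt_self h]
  · rw [two_mul, ← e]
    simp only [Q, tau, Matrix.of_apply, ne_eq, h, not_false_eq_true, if_true, θ.ρ_self i h,
      θ.η_self h]
    push_cast
    ring

theorem normSq_Q (i j : Fin p) : Complex.normSq (θ.Q i j) = Real.Gamma (θ.H i + θ.H j + 1) ^ 2 *
    (if θ.H i + θ.H j ≠ 1 then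
      θ.ρ i j ^ 2 * Real.sin (Real.pi / 2 * (θ.H i + θ.H j)) ^ 2
        + θ.η i j ^ 2 * Real.cos (Real.pi / 2 * (θ.H i + θ.H j)) ^ 2
    else θ.ρt i j ^ 2 + Real.pi ^ 2 / 4 * θ.ηt i j ^ 2) := by
  have key : ∀ a b : ℝ, Complex.normSq ((a : ℂ) - Complex.I * (b : ℂ)) = a ^ 2 + b ^ 2 := by
    intro a b
    simp [Complex.normSq_apply]
    ring
  simp only [Q, tau, Matrix.of_apply, Complex.normSq_mul, Complex.normSq_ofReal]
  split_ifs
  all_goals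
    rw [key]
    ring

theorem posSemidef_iff_coherence_le_one (θ : MfBmParams 2) :
    θ.Q.PosSemidef ↔ θ.coherence 0 1 ≤ 1 := by
  have hpos : ∀ i, 0 < Real.Gamma (2 * θ.H i + 1) ∧ 0 < Real.sin (Real.pi * θ.H i) := by
    intro i
    have h := θ.H_mem i
    refine ⟨Real.Gamma_pos_of_pos (by linarith [h.1]),
      Real.sin_pos_of_pos_of_lt_pi (mul_pos Real.pi_pos h.1) ?_⟩
    nlinarith [Real.pi_pos, h.2]
  rw [θ.isHermitian_Q.posSemidef_fin_two_iff (mul_pos (hpos 0).1 (hpos 0).2) (θ.Q_self 0)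
    (θ.Q_self 1), normSq_Q, coherence, div_mul_div_comm, div_le_one (mul_pos
    (mul_pos (hpos 0).1 (hpos 1).1) (mul_pos (hpos 0).2 (hpos 1).2))]
  rw [mul_mul_mul_comm (Real.Gamma (2 * θ.H 0 + 1))]

end MfBmParams

theorem proposition16 :
    (∀ (p : ℕ) (θ : MfBmParams p),
      (IsMfBmCovariance θ.H θ.covMatrix ↔ θ.Q.PosSemidef) ∧
      (IsCovarianceMatrixFunction θ.covMatrix ↔ θ.Q.PosSemidef)) ∧
    (∀ θ : MfBmParams 2, θ.Q.PosSemidef ↔ θ.coherence 0 1 ≤ 1) :=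
  ⟨fun _ θ ↦ ⟨θ.isMfBmCovariance_iff, θ.isCovarianceMatrixFunction_iff⟩,
    MfBmParams.posSemidef_iff_coherence_le_one⟩
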